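/- Let $T\ge 0$ be an integer, let $(\Omega,\mathcal F,(\mathcal F_t)_{t=0,\dots,T},\mathbb P)$ be a filtered probability space with $\mathcal F$ separable (it suffices that it is so up to $\mathbb P$-approximation: some countable family $\mathcal A\subset\mathcal F$ is such that every $B\in\mathcal F$ and $\varepsilon>0$ admit $A\in\mathcal A$ with $\mathbb P(A\triangle B)<\varepsilon$), and let $S=(S_t)_{t=0,\dots,T}$ be an adapted $\mathbb R^d$-valued process. Let $f=(f^1,\dots,f^L)$ and $g=(g^1,\dots,g^M)$ be $\mathcal F_T$-measurable European payoffs with prices $\bar f\in\mathbb R^L$, $\bar g\in\mathbb R^M$, and let $h=(h^1,\dots,h^N)$ be adapted American payoff processes $h^k=(h^k_t)_{t=0,\dots,T}$ with prices $\bar h\in\mathbb R^N$; $g$ and $h$ are bounded. The options $f$ can be bought and sold at time $0$; $g$ and $h$ can only be bought. A liquidating strategy is an adapted real process $\eta=(\eta_t)_{t=0,\dots,T}$ with $\eta_t\ge 0$ for all $t$ and $\sum_{t=0}^T\eta_t=1$ $\mathbb P$-a.s.; $\mathbb T$ is the set of these. For an American payoff process $\phi$ put $\eta(\phi)=\sum_{t=0}^T\phi_t\eta_t$.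 A semi-static strategy is a tuple $(H,a,b,c,\mu)$ with $H$ an adapted $\mathbb R^d$-valued process, $a\in\mathbb R^L$, $b\in\mathbb R_+^M$, $c\in\mathbb R_+^N$, $\mu\in\mathbb T^N$. For prices $p\in\mathbb R^M$, $q\in\mathbb R^N$ its terminal value is $$\Phi_{p,q}(H,a,b,c,\mu)=\sum_{t=0}^{T-1}H_t\cdot(S_{t+1}-S_t)+\sum_{i=1}^L a^i(f^i-\bar f^i)+\sum_{j=1}^M b^j(g^j-p^j)+\sum_{k=1}^N c^k(\mu^k(h^k)-q^k).$$ NA with respect to $p,q$ means that for every semi-static strategy, $\Phi_{p,q}\ge 0$ $\mathbb P$-a.s. implies $\Phi_{p,q}=0$ $\mathbb P$-a.s. SNA means that there are $\varepsilon_g\in(0,\infty)^M$ and $\varepsilon_h\in(0,\infty)^N$ such that NA holds with respect to $\bar g-\varepsilon_g,\ \bar h-\varepsilon_h$. Let $\mathcal T$ be the set of stopping times with values in $\{0,\dots,T\}$, and let $\mathcal Q$ be the set of probability measures $\mathbb Q$ on $\mathcal F$, equivalent to $\mathbb P$, under which $S$ is a martingale, each $f^i$ is integrable, $\mathbb E_{\mathbb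 Q}f^i=\bar f^i$ for all $i$, $\mathbb E_{\mathbb Q}g^j<\bar g^j$ for all $j$, and $\sup_{\tau\in\mathcal T}\mathbb E_{\mathbb Q}h^k_\tau<\bar h^k$ for all $k$. Let $\psi$ be a bounded $\mathcal F_T$-measurable random variable and $\phi=(\phi_t)_{t=0,\dots,T}$ a bounded adapted real process. Define the sub-hedging prices $$\pi_{eu}(\psi)=\sup\{x\in\mathbb R:\ \exists(H,a,b,c,\mu),\ \Phi_{\bar g,\bar h}(H,a,b,c,\mu)+\psi\ge x\ \ \mathbb P\text{-a.s.}\},$$ $$\pi_{am}(\phi)=\sup\{x\in\mathbb R:\ \exists(H,a,b,c,\mu),\ \exists\,\eta\in\mathbb T,\ \Phi_{\bar g,\bar h}(H,a,b,c,\mu)+\eta(\phi)\ge x\ \ \mathbb P\text{-a.s.}\}.$$ Theorem. Assume SNA. Then $$\pi_{eu}(\psi)=\inf_{\mathbb Q\in\mathcal Q}\mathbb E_{\mathbb Q}\psi,\qquad \pi_{am}(\phi)=\inf_{\mathbb Q\in\mathcal Q}\ \sup_{\tau\in\mathcal T}\mathbb E_{\mathbb Q}\phi_\tau,$$ where suprema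 and infima are taken in $[-\infty,\infty]$. Moreover, there is a semi-static strategy $(H^*,a^*,b^*,c^*,\mu^*)$ with $$\Phi_{\bar g,\bar h}(H^*,a^*,b^*,c^*,\mu^*)+\psi\ \ge\ \pi_{eu}(\psi)\quad\mathbb P\text{-a.s.},$$ and there are a semi-static strategy $(H^{**},a^{**},b^{**},c^{**},\mu^{**})$ and $\eta^{**}\in\mathbb T$ with $$\Phi_{\bar g,\bar h}(H^{**},a^{**},b^{**},c^{**},\mu^{**})+\eta^{**}(\phi)\ \ge\ \pi_{am}(\phi)\quad\mathbb P\text{-a.s.}$$ -/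

import Mathlib

open MeasureTheory ProbabilityTheory

namespace SemiStatic

/-- A market in discrete time `t = 0, …, T` on a probability space `(Ω, 𝓕, P)`:
a stock price process `S` in `ℝᵈ`, European options `f` (bought and sold at `fbar`),
bounded European options `g` (only bought, at `gbar`), and bounded American options `h`
(only bought, at `hbar`); `h k t` is the payoff of the `k`-th American option at time `t`. -/
structure Market (Ω : Type*) [mΩ : MeasurableSpace Ω] (T d L M N : ℕ) where
  ℱ : Filtration (Fin (T + 1)) mΩ
  S : Fin (T + 1) → Ω → (Fin d → ℝ)
  f : Fin L → Ω → ℝ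
  g : Fin M → Ω → ℝ
  h : Fin N → Fin (T + 1) → Ω → ℝ
  fbar : Fin L → ℝ
  gbar : Fin M → ℝ
  hbar : Fin N → ℝ
  adapted_S : Adapted ℱ S
  measurable_f : ∀ i, Measurable[ℱ (Fin.last T)] (f i)
  measurable_g : ∀ j, Measurable[ℱ (Fin.last T)] (g j)
  adapted_h : ∀ k, Adapted ℱ (h k)
  bounded_g : ∃ K : ℝ, ∀ j ω, |g j ω| ≤ K
  bounded_h : ∃ K : ℝ, ∀ k t ω, |h k t ω| ≤ K

variable {Ω : Type*} [mΩ : MeasurableSpace Ω] {T d L M N : ℕ}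

/-- Liquidating strategies (the set `𝕋`): nonnegative adapted processes that liquidate, over the
dates `0, …, T`, exactly one unit almost surely. -/
structure IsLiquidating (ℱ : Filtration (Fin (T + 1)) mΩ) (P : Measure Ω)
    (η : Fin (T + 1) → Ω → ℝ) : Prop where
  adapted : Adapted ℱ η
  nonneg : ∀ t ω, 0 ≤ η t ω
  sum_eq_one : ∀ᵐ ω ∂P, ∑ t, η t ω = 1

/-- The payoff `η(φ) = ∑ₜ φₜ ηₜ` of an American option `φ` liquidated along `η`. -/
def liquidate (η φ : Fin (T + 1) → Ω → ℝ) (ω : Ω) : ℝ :=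
  ∑ t, φ t ω * η t ω

/-- Stopping times (the set `𝒯`) with values in `{0, …, T}`. -/
def stoppingTimes (ℱ : Filtration (Fin (T + 1)) mΩ) : Set (Ω → Fin (T + 1)) :=
  {τ | IsStoppingTime ℱ (fun ω => (τ ω : WithTop (Fin (T + 1))))}

/-- `sup_{τ ∈ 𝒯} E_Q φ_τ`, as an extended real number. -/
noncomputable def optimalStoppingValue (ℱ : Filtration (Fin (T + 1)) mΩ) (Q : Measure Ω)
    (φ : Fin (T + 1) → Ω → ℝ) : EReal :=
  ⨆ τ ∈ stoppingTimes ℱ, ((∫ ω, φ (τ ω) ω ∂Q : ℝ) : EReal)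

/-- The data `(H, a, b, c, μ)` of a semi-static trading strategy. -/
structure Strategy (Ω : Type*) (T d L M N : ℕ) where
  H : Fin (T + 1) → Ω → (Fin d → ℝ)
  a : Fin L → ℝ
  b : Fin M → ℝ
  c : Fin N → ℝ
  μ : Fin N → Fin (T + 1) → Ω → ℝ

namespace Market

/-- Admissible semi-static strategies: `H` is adapted, `b` and `c` are componentwise nonnegative,
and each `μ k` is a liquidating strategy. -/
structure Admissible (mkt : Market Ω T d L M N) (P : Measure Ω)
    (s : Strategy Ω T d L M N) : Prop where
  adapted_H : Adapted mkt.ℱ s.H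
  b_nonneg : ∀ j, 0 ≤ s.b j
  c_nonneg : ∀ k, 0 ≤ s.c k
  liquidating : ∀ k, IsLiquidating mkt.ℱ P (s.μ k)

/-- The terminal gain `H · S = ∑_{t < T} H_t (S_{t+1} - S_t)` from trading the stocks. -/
def stockGain (mkt : Market Ω T d L M N) (H : Fin (T + 1) → Ω → (Fin d → ℝ)) (ω : Ω) : ℝ :=
  ∑ t : Fin T, ∑ i : Fin d,
    H t.castSucc ω i * (mkt.S t.succ ω i - mkt.S t.castSucc ω i)

/-- The terminal value `Φ` of a semi-static strategy started from zero wealth, when the options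
`g` and `h` are bought at the prices `pg` and `ph`. -/
def terminalValue (mkt : Market Ω T d L M N) (pg : Fin M → ℝ) (ph : Fin N → ℝ)
    (s : Strategy Ω T d L M N) (ω : Ω) : ℝ :=
  mkt.stockGain s.H ω
    + ∑ i, s.a i * (mkt.f i ω - mkt.fbar i)
    + ∑ j, s.b j * (mkt.g j ω - pg j)
    + ∑ k, s.c k * (liquidate (s.μ k) (mkt.h k) ω - ph k)

/-- No arbitrage with respect to the prices `pg` and `ph` of `g` and `h`. -/
def NA (mkt : Market Ω T d L M N) (P : Measure Ω) (pg : Fin M → ℝ) (ph : Fin N → ℝ) : Prop :=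
  ∀ s : Strategy Ω T d L M N, mkt.Admissible P s →
    (∀ᵐ ω ∂P, 0 ≤ mkt.terminalValue pg ph s ω) →
    ∀ᵐ ω ∂P, mkt.terminalValue pg ph s ω = 0

/-- Strict no arbitrage: no arbitrage still holds after all prices of `g` and `h` are lowered by
some positive amounts. -/
def SNA (mkt : Market Ω T d L M N) (P : Measure Ω) : Prop :=
  ∃ (εg : Fin M → ℝ) (εh : Fin N → ℝ), (∀ j, 0 < εg j) ∧ (∀ k, 0 < εh k) ∧
    mkt.NA P (fun j => mkt.gbar j - εg j) (fun k => mkt.hbar k - εh k)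

/-- The set `𝒬` of equivalent martingale measures `Q` with `E_Q f = fbar`, `E_Q g < gbar` and
`sup_τ E_Q h_τ < hbar`, componentwise. -/
structure IsPricingMeasure (mkt : Market Ω T d L M N) (P Q : Measure Ω) : Prop where
  prob : IsProbabilityMeasure Q
  ac : Q ≪ P
  ac' : P ≪ Q
  martingale : Martingale mkt.S mkt.ℱ Q
  integrable_f : ∀ i, Integrable (mkt.f i) Q
  price_f : ∀ i, ∫ ω, mkt.f i ω ∂Q = mkt.fbar i
  price_g : ∀ j, ∫ ω, mkt.g j ω ∂Q < mkt.gbar j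
  price_h : ∀ k, optimalStoppingValue mkt.ℱ Q (mkt.h k) < (mkt.hbar k : EReal)

/-- The sub-hedging price of a European option `ψ`, as a supremum in the extended reals. -/
noncomputable def subHedgeEu (mkt : Market Ω T d L M N) (P : Measure Ω) (ψ : Ω → ℝ) : EReal :=
  sSup {y : EReal | ∃ x : ℝ, y = (x : EReal) ∧ ∃ s : Strategy Ω T d L M N,
    mkt.Admissible P s ∧
    ∀ᵐ ω ∂P, x ≤ mkt.terminalValue mkt.gbar mkt.hbar s ω + ψ ω}

/-- The sub-hedging price of an American option `φ`, as a supremum in the extended reals. -/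
noncomputable def subHedgeAm (mkt : Market Ω T d L M N) (P : Measure Ω)
    (φ : Fin (T + 1) → Ω → ℝ) : EReal :=
  sSup {y : EReal | ∃ x : ℝ, y = (x : EReal) ∧ ∃ (s : Strategy Ω T d L M N)
    (η : Fin (T + 1) → Ω → ℝ), mkt.Admissible P s ∧ IsLiquidating mkt.ℱ P η ∧
    ∀ᵐ ω ∂P, x ≤ mkt.terminalValue mkt.gbar mkt.hbar s ω + liquidate η φ ω}

end Market

end SemiStatic

/-!
The proof is the functional-analytic one: the claims that can be superreplicated at zero cost form
a convex cone `hedgeCone`, strict no arbitrage makes this cone closed under almost sure limits, and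
closedness gives both attainment and, by separation, the pricing measures.

*Closedness.* The options `f` and every stock in every period are regarded as finitely many assets
`ξ i`, traded at a volume measurable with respect to `G i`, where the σ-algebras `G i` are ordered.
Adding one asset keeps a closed cone closed (`AEClosed.add_step`): where the volumes of an
approximating sequence stay bounded they converge along a measurable random subsequence, and where
they explode a rescaled limit shows that the asset is redundant. Each of the options `g` and `h`
contributes the multiples of a set of payoffs that is compact with respect to forward convex
combinations (`ConvexlyCompact`); for the American options this is a Komlós type argument in `L²`
for the liquidating strategies. Adding such a ray keeps the cone closed (`AEClosed.add_ray`), since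
exploding multiples would, at the lowered prices of strict no arbitrage, produce an arbitrage.

*Strong duality.* Let `W` be `{ψ}`, or the set of all payoffs `η(φ)`. The claims superreplicable
with the help of one element of `W` again form a closed convex set, so the optimal level is
attained. A higher level is separated from that set by a nonnegative density in `L²` of an equivalent measure
under which `S` and `f` are square integrable. Adding a small multiple of a strictly positive
density that prices the cone for slightly lowered option prices (Kreps–Yan, `exists_pos_mem_polarDensities`)
makes it equivalent and the option inequalities strict. As the separation holds for all liquidating
strategies at once, it provides the minimax exchange needed for American claims.

*Weak duality.* Under a pricing measure, trading gains that are bounded below by an integrable claim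
have nonpositive expectation (`integral_trading_nonpos`), and the expected payoff of a liquidating
strategy is an average of expected payoffs at stopping times (`integral_liquidate_le`).
-/

open MeasureTheory ProbabilityTheory Filter Topology

/-! ### Closedness of the cone generated by trading -/

namespace SemiStatic

variable {Ω : Type*}

/-- A set of claims that is a convex cone, allows throwing money away, and admits rescaling by
nonnegative `G`-measurable factors. Claims are plain functions and need not be measurable:
domination is only asked almost surely. -/
structure IsClaimCone (G : MeasurableSpace Ω) [MeasurableSpace Ω] (P : Measure Ω)
    (D : Set (Ω → ℝ)) : Prop where
  zero_mem : (0 : Ω → ℝ) ∈ D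
  add_mem : ∀ {X Y}, X ∈ D → Y ∈ D → X + Y ∈ D
  mul_mem : ∀ {H X : Ω → ℝ}, Measurable[G] H → (∀ ω, 0 ≤ H ω) → X ∈ D → H * X ∈ D
  mono : ∀ {X Y : Ω → ℝ}, X ∈ D → Y ≤ᵐ[P] X → Y ∈ D

/-- Closedness under almost sure limits of sequences. -/
def AEClosed [MeasurableSpace Ω] (P : Measure Ω) (D : Set (Ω → ℝ)) : Prop :=
  ∀ (X : ℕ → Ω → ℝ) (Y : Ω → ℝ), (∀ n, X n ∈ D) →
    (∀ᵐ ω ∂P, Tendsto (fun n => X n ω) atTop (𝓝 (Y ω))) → Y ∈ D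

variable {G G' : MeasurableSpace Ω} [mΩ : MeasurableSpace Ω] {P : Measure Ω} {D : Set (Ω → ℝ)}

theorem IsClaimCone.smul_mem (hD : IsClaimCone G P D) {c : ℝ} (hc : 0 ≤ c) {X : Ω → ℝ}
    (hX : X ∈ D) : c • X ∈ D :=
  hD.mul_mem (H := fun _ => c) measurable_const (fun _ => hc) hX

theorem IsClaimCone.sum_mem (hD : IsClaimCone G P D) {ι : Type*} (s : Finset ι)
    {X : ι → Ω → ℝ} (hX : ∀ i ∈ s, X i ∈ D) : ∑ i ∈ s, X i ∈ D := by
  classical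
  induction s using Finset.induction_on with
  | empty => simpa using hD.zero_mem
  | insert i s hi ih =>
    rw [Finset.sum_insert hi]
    exact hD.add_mem (hX i (by simp)) (ih fun j hj => hX j (by simp [hj]))

theorem IsClaimCone.convex (hD : IsClaimCone G P D) : Convex ℝ D :=
  fun _ hX _ hY _ _ ha hb _ => hD.add_mem (hD.smul_mem ha hX) (hD.smul_mem hb hY)

omit mΩ in
/-- A measurable cluster-point selection: a bounded sequence of `G`-measurable functions converges
to its upper limit along a `G`-measurable random subsequence. -/
theorem exists_measurable_subseq {ρ : ℕ → Ω → ℝ} (hρ : ∀ n, Measurable[G] (ρ n))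
    (hb : ∀ n ω, |ρ n ω| ≤ 1) :
    ∃ (r : Ω → ℝ) (σ : ℕ → Ω → ℕ), Measurable[G] r ∧ (∀ ω, |r ω| ≤ 1) ∧
      (∀ n, Measurable[G] (σ n)) ∧ (∀ n ω, n ≤ σ n ω) ∧
      ∀ ω, Tendsto (fun n => ρ (σ n ω) ω) atTop (𝓝 (r ω)) := by
  classical
  set r : Ω → ℝ := fun ω => limsup (fun n => ρ n ω) atTop with hr
  have hrm : Measurable[G] r := Measurable.limsup hρ
  have hub : ∀ ω, IsBoundedUnder (· ≤ ·) atTop fun n => ρ n ω := fun ω =>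
    isBoundedUnder_of ⟨1, fun n => (abs_le.1 (hb n ω)).2⟩
  have hlb : ∀ ω, IsBoundedUnder (· ≥ ·) atTop fun n => ρ n ω := fun ω =>
    isBoundedUnder_of ⟨-1, fun n => (abs_le.1 (hb n ω)).1⟩
  have hex : ∀ n ω, ∃ m, n ≤ m ∧ |ρ m ω - r ω| < 1 / ((n : ℝ) + 1) := by
    intro n ω
    have hpos : 0 < 1 / ((n : ℝ) + 1) := by positivity
    have h1 : ∃ᶠ m in atTop, r ω - 1 / ((n : ℝ) + 1) < ρ m ω :=
      frequently_lt_of_lt_limsup (hlb ω).isCoboundedUnder_flip (by simp only [hr]; linarith)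
    have h2 : ∀ᶠ m in atTop, ρ m ω < r ω + 1 / ((n : ℝ) + 1) :=
      eventually_lt_of_limsup_lt (by simp only [hr]; linarith) (hub ω)
    obtain ⟨m, h3, h4, h5⟩ := (h1.and_eventually (h2.and (eventually_ge_atTop n))).exists
    exact ⟨m, h5, by rw [abs_lt]; constructor <;> linarith⟩
  have hlim : ∀ ω, Tendsto (fun n => ρ (Nat.find (hex n ω)) ω) atTop (𝓝 (r ω)) := by
    intro ω
    rw [tendsto_iff_norm_sub_tendsto_zero]
    refine squeeze_zero (fun _ => norm_nonneg _) (fun n => ?_)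
      tendsto_one_div_add_atTop_nhds_zero_nat
    exact (Nat.find_spec (hex n ω)).2.le
  refine ⟨r, fun n ω => Nat.find (hex n ω), hrm, fun ω => ?_, fun n => ?_,
    fun n ω => (Nat.find_spec (hex n ω)).1, hlim⟩
  · exact le_of_tendsto (hlim ω).abs (Eventually.of_forall fun n => hb _ ω)
  · refine @measurable_find Ω G _ _ (hex n) fun m => ?_
    exact (MeasurableSet.const _).inter
      (measurableSet_lt (((hρ m).sub hrm).abs) measurable_const)

/-- Claims of a closed cone may be pasted along a `G`-measurable random index. -/
theorem IsClaimCone.paste (hD : IsClaimCone G P D) (hc : AEClosed P D) {Y : ℕ → Ω → ℝ}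
    (hY : ∀ n, Y n ∈ D) {σ : Ω → ℕ} (hσ : Measurable[G] σ) : (fun ω => Y (σ ω) ω) ∈ D := by
  classical
  refine hc (fun n => ∑ k ∈ Finset.range n, (fun ω => if σ ω = k then (1 : ℝ) else 0) * Y k) _
    (fun n => hD.sum_mem _ fun k _ => hD.mul_mem ?_ ?_ (hY k)) (ae_of_all _ fun ω => ?_)
  · exact Measurable.ite (hσ (measurableSet_singleton k)) measurable_const measurable_const
  · intro ω; split_ifs <;> norm_num
  · refine tendsto_const_nhds.congr' ?_
    filter_upwards [eventually_gt_atTop (σ ω)] with n hn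
    simp [Finset.sum_apply, hn]

/-- If every trade of `ξ` at `G`-measurable volume which is dominated in `D` can be reversed in
`D`, then adding `ξ` as a `G`-tradable asset keeps the cone closed. Where the volumes of an
approximating sequence explode, the rescaled limit shows that `ξ` is redundant, so there the
volumes can be taken to be zero. -/
theorem AEClosed.add_step (hD : IsClaimCone G P D) (hc : AEClosed P D) {ξ : Ω → ℝ}
    (hred : ∀ H : Ω → ℝ, Measurable[G] H → H * ξ ∈ D → -(H * ξ) ∈ D) :
    AEClosed P {X | ∃ H : Ω → ℝ, Measurable[G] H ∧ X - H * ξ ∈ D} := by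
  classical
  intro X X' hX hlim
  choose H hH hXH using hX
  set ρ : ℕ → Ω → ℝ := fun n ω => H n ω / (1 + |H n ω|) with hρ
  have hpos : ∀ n ω, 0 < 1 + |H n ω| := fun n ω => by positivity
  have hρm : ∀ n, Measurable[G] (ρ n) := fun n =>
    (hH n).div (measurable_const.add (continuous_abs.measurable.comp (hH n)))
  have hρb : ∀ n ω, |ρ n ω| ≤ 1 := fun n ω => by
    simp only [hρ, abs_div, abs_of_pos (hpos n ω)]
    rw [div_le_one (hpos n ω)]; linarith
  have habs : ∀ n ω, 1 - |ρ n ω| = 1 / (1 + |H n ω|) := fun n ω => by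
    simp only [hρ, abs_div, abs_of_pos (hpos n ω)]
    field_simp [(hpos n ω).ne']; ring
  have hHρ : ∀ n ω, H n ω = ρ n ω / (1 - |ρ n ω|) := fun n ω => by
    rw [habs]; simp only [hρ]; field_simp [(hpos n ω).ne']
  obtain ⟨r, σ, hr, hrb, hσ, hσn, hlimσ⟩ := exists_measurable_subseq hρm hρb
  have hσt : ∀ ω, Tendsto (fun n => σ n ω) atTop atTop := fun ω =>
    tendsto_atTop_mono (fun n => hσn n ω) tendsto_id
  set F : Set Ω := {ω | 1 ≤ |r ω|} with hF
  have hFm : MeasurableSet[G] F :=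
    measurableSet_le measurable_const (continuous_abs.measurable.comp hr)
  have hrF : Measurable[G] (F.indicator r) := hr.indicator hFm
  have hind : Measurable[G] (F.indicator fun _ => (1 : ℝ)) := measurable_const.indicator hFm
  have hrσ : ∀ ω, Tendsto (fun n => 1 - |ρ (σ n ω) ω|) atTop (𝓝 (1 - |r ω|)) := fun ω =>
    tendsto_const_nhds.sub (hlimσ ω).abs
  -- where the volumes explode, `r = ±1` and the rescaled limit of the sequence is `-r ξ`
  have hneg : -(F.indicator r * ξ) ∈ D := by
    have h1 : ∀ k, (fun ω => F.indicator (fun _ => (1 : ℝ)) ω * (1 - |ρ k ω|)) * (X k - H k * ξ)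
        ∈ D := fun k => by
      refine hD.mul_mem (hind.mul (measurable_const.sub
        (continuous_abs.measurable.comp (hρm k)))) (fun ω => ?_) (hXH k)
      exact mul_nonneg (Set.indicator_nonneg (fun _ _ => zero_le_one) ω)
        (sub_nonneg.2 (hρb k ω))
    refine hc _ _ (fun n => hD.paste hc h1 (hσ n)) ?_
    filter_upwards [hlim] with ω hω
    by_cases hωF : ω ∈ F
    · have hr1 : |r ω| = 1 := le_antisymm (hrb ω) hωF
      have h2 := ((hrσ ω).mul (hω.comp (hσt ω))).sub ((hlimσ ω).mul_const (ξ ω))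
      rw [hr1, sub_self, zero_mul, zero_sub] at h2
      simp only [Pi.neg_apply, Pi.mul_apply, Set.indicator_of_mem hωF, Pi.sub_apply]
      refine h2.congr fun n => ?_
      have h3 := habs (σ n ω) ω
      have h4 : ρ (σ n ω) ω = (1 - |ρ (σ n ω) ω|) * H (σ n ω) ω := by
        rw [h3]; simp only [hρ]; ring
      simp only [Function.comp]
      rw [one_mul, mul_sub, ← mul_assoc, ← h4]
    · simp [Set.indicator_of_notMem hωF]
  have hpos' : F.indicator r * ξ ∈ D := by
    have := hred (-(F.indicator r)) hrF.neg (by rwa [neg_mul])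
    rwa [neg_mul, neg_neg] at this
  have hall : ∀ k, (fun ω => F.indicator (fun _ => (1 : ℝ)) ω * H k ω) * ξ ∈ D := fun k => by
    have hm : Measurable[G] (H k * r) := (hH k).mul hr
    have h1 := hD.add_mem
      (hD.mul_mem (hm.max measurable_const) (fun ω => le_max_right _ (0 : ℝ)) hpos')
      (hD.mul_mem (hm.neg.max measurable_const) (fun ω => le_max_right _ (0 : ℝ)) hneg)
    refine hD.mono h1 (ae_of_all _ fun ω => le_of_eq ?_)
    simp only [Pi.mul_apply, Pi.add_apply, Pi.neg_apply]
    by_cases hωF : ω ∈ F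
    · have hr1 : r ω * r ω = 1 := by
        rw [← abs_mul_abs_self, le_antisymm (hrb ω) hωF, one_mul]
      have h5 : max (H k ω * r ω) 0 - max (-(H k ω * r ω)) 0 = H k ω * r ω :=
        max_zero_sub_max_neg_zero_eq_self _
      simp only [Set.indicator_of_mem hωF]
      linear_combination (-ξ ω * r ω) * h5 - H k ω * ξ ω * hr1
    · simp [Set.indicator_of_notMem hωF]
  -- on `F` the denominator vanishes, so this volume is zero there
  refine ⟨fun ω => r ω / (1 - |r ω|),
    hr.div (measurable_const.sub (continuous_abs.measurable.comp hr)), ?_⟩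
  refine hc _ _ (fun n => hD.paste hc (fun k => hD.add_mem (hXH k) (hall k)) (hσ n)) ?_
  filter_upwards [hlim] with ω hω
  have hXσ := hω.comp (hσt ω)
  by_cases hωF : ω ∈ F
  · have hr1 : |r ω| = 1 := le_antisymm (hrb ω) hωF
    simpa [Set.indicator_of_mem hωF, hr1, Function.comp_def] using hXσ
  · have hne : 1 - |r ω| ≠ 0 := by
      have : |r ω| < 1 := not_le.1 hωF
      linarith
    have h2 := hXσ.sub (((hlimσ ω).div (hrσ ω) hne).mul_const (ξ ω))
    simp only [Pi.add_apply, Pi.mul_apply, Pi.sub_apply, Set.indicator_of_notMem hωF, zero_mul,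
      add_zero]
    refine h2.congr fun n => ?_
    rw [hHρ (σ n ω) ω]; rfl

/-- The claims dominated by the outcome of trading the assets `ξ i`, `i ∈ s`, where the volume
traded of `ξ i` is `G i`-measurable. -/
def tradingCone {ι : Type*} (P : Measure Ω) (G : ι → MeasurableSpace Ω) (ξ : ι → Ω → ℝ)
    (s : Finset ι) : Set (Ω → ℝ) :=
  {X | ∃ H : ι → Ω → ℝ, (∀ i, Measurable[G i] (H i)) ∧
    X ≤ᵐ[P] fun ω => ∑ i ∈ s, H i ω * ξ i ω}

theorem isClaimCone_tradingCone {ι : Type*} {G : ι → MeasurableSpace Ω}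
    {ξ : ι → Ω → ℝ} {s : Finset ι} (hG : ∀ i ∈ s, G' ≤ G i) :
    IsClaimCone G' P (tradingCone P G ξ s) where
  zero_mem := ⟨fun _ _ => 0, fun _ => measurable_const, ae_of_all _ fun ω => by simp⟩
  add_mem := by
    rintro X Y ⟨H, hH, hX⟩ ⟨K, hK, hY⟩
    refine ⟨fun i ω => H i ω + K i ω, fun i => (hH i).add (hK i), ?_⟩
    filter_upwards [hX, hY] with ω h1 h2
    simp only [Pi.add_apply, add_mul, Finset.sum_add_distrib]
    exact add_le_add h1 h2
  mul_mem := by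
    classical
    rintro K X hK hK0 ⟨H, hH, hX⟩
    refine ⟨fun i => if i ∈ s then K * H i else 0, fun i => ?_, ?_⟩
    · by_cases hi : i ∈ s
      · simpa only [hi, if_true] using (hK.mono (hG i hi) le_rfl).mul (hH i)
      · simp only [hi, if_false]
        exact measurable_const (a := (0 : ℝ))
    · filter_upwards [hX] with ω h1
      refine (mul_le_mul_of_nonneg_left h1 (hK0 ω)).trans_eq ?_
      rw [Finset.mul_sum]
      refine Finset.sum_congr rfl fun i hi => ?_
      simp [hi, mul_assoc]
  mono := by
    rintro X Y ⟨H, hH, hX⟩ hYX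
    exact ⟨H, hH, hYX.trans hX⟩

/-- Under absence of arbitrage the trading cone of finitely many assets is closed, provided the
information available for the assets is ordered. The assets are added one at a time, the one with
the most information first. -/
theorem aeClosed_tradingCone {ι : Type*} [Fintype ι] {G : ι → MeasurableSpace Ω}
    {ξ : ι → Ω → ℝ} (rk : ι → ℕ) (hrk : ∀ i j, rk i ≤ rk j → G i ≤ G j)
    (hNA : ∀ H : ι → Ω → ℝ, (∀ i, Measurable[G i] (H i)) →
      (∀ᵐ ω ∂P, 0 ≤ ∑ i, H i ω * ξ i ω) → ∀ᵐ ω ∂P, ∑ i, H i ω * ξ i ω = 0)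
    (s : Finset ι) : AEClosed P (tradingCone P G ξ s) := by
  classical
  induction s using Finset.induction_on_min_value rk with
  | empty =>
    rintro X Y hX hlim
    refine ⟨fun _ _ => 0, fun _ => measurable_const, ?_⟩
    have : ∀ᵐ ω ∂P, ∀ n, X n ω ≤ 0 := ae_all_iff.2 fun n => by
      obtain ⟨H, -, h⟩ := hX n
      filter_upwards [h] with ω hω
      simpa using hω
    filter_upwards [this, hlim] with ω h1 h2
    simpa using le_of_tendsto h2 (Eventually.of_forall h1)
  | insert i s hi hmin ih =>
    have hcone : IsClaimCone (G i) P (tradingCone P G ξ s) :=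
      isClaimCone_tradingCone fun j hj => hrk _ _ (hmin j hj)
    have hstep := ih.add_step hcone (ξ := ξ i) ?_
    · convert hstep using 1
      ext X
      constructor
      · rintro ⟨H, hH, hX⟩
        refine ⟨H i, hH i, H, hH, ?_⟩
        filter_upwards [hX] with ω h
        rw [Finset.sum_insert hi] at h
        simp only [Pi.sub_apply, Pi.mul_apply]
        linarith
      · rintro ⟨K, hK, H, hH, hX⟩
        refine ⟨Function.update H i K, fun j => ?_, ?_⟩
        · rcases eq_or_ne j i with rfl | hj
          · simpa using hK
          · simpa [hj] using hH j
        · filter_upwards [hX] with ω h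
          rw [Finset.sum_insert hi, Function.update_self]
          have : ∑ j ∈ s, Function.update H i K j ω * ξ j ω = ∑ j ∈ s, H j ω * ξ j ω :=
            Finset.sum_congr rfl fun j hj => by
              rw [Function.update_of_ne (ne_of_mem_of_not_mem hj hi)]
          rw [this]
          simp only [Pi.sub_apply, Pi.mul_apply] at h
          linarith
    · -- otherwise a superreplication of `K ξ` by the later assets would be an arbitrage
      rintro K hK ⟨H, hH, hX⟩
      have hsum : ∀ ω, ∑ j, (if j = i then -K ω else if j ∈ s then H j ω else 0) * ξ j ω
          = ∑ j ∈ s, H j ω * ξ j ω - K ω * ξ i ω := fun ω => by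
        have : ∀ j, (if j = i then -K ω else if j ∈ s then H j ω else 0) * ξ j ω
            = (if j ∈ s then H j ω * ξ j ω else 0) + if j = i then -K ω * ξ i ω else 0 := by
          intro j
          rcases eq_or_ne j i with rfl | hj
          · simp [hi]
          · simp [hj]
        rw [Finset.sum_congr rfl fun j _ => this j, Finset.sum_add_distrib]
        simp [sub_eq_add_neg]
      have hz := hNA (fun j ω => if j = i then -K ω else if j ∈ s then H j ω else 0)
        (fun j => ?_) ?_
      · refine ⟨fun j ω => -H j ω, fun j => (hH j).neg, ?_⟩
        filter_upwards [hz] with ω h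
        rw [hsum] at h
        simp only [Pi.neg_apply, Pi.mul_apply, neg_mul, Finset.sum_neg_distrib]
        linarith
      · rcases eq_or_ne j i with rfl | hj
        · simp only [if_true]
          exact hK.neg
        · by_cases hjs : j ∈ s
          · simpa [hj, hjs] using hH j
          · simp [hj, hjs]
      · filter_upwards [hX] with ω h
        rw [hsum]
        simp only [Pi.mul_apply] at h
        linarith

end SemiStatic

/-! ### Forward convex combinations and convex compactness -/

namespace SemiStatic

/-- Finitely supported convex weights on the indices from `n` on. -/
def tailWeights (n : ℕ) : Set (ℕ →₀ ℝ) :=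
  {a | (∀ m, 0 ≤ a m) ∧ (∀ m ∈ a.support, n ≤ m) ∧ ∑ m ∈ a.support, a m = 1}

theorem tailWeights_anti {k n : ℕ} (h : k ≤ n) : tailWeights n ⊆ tailWeights k :=
  fun _ ha => ⟨ha.1, fun m hm => h.trans (ha.2.1 m hm), ha.2.2⟩

theorem single_mem_tailWeights (n : ℕ) : Finsupp.single n 1 ∈ tailWeights n := by
  have hs : (Finsupp.single n (1 : ℝ)).support = {n} :=
    Finsupp.support_single _ one_ne_zero
  refine ⟨fun m => ?_, fun m hm => ?_, ?_⟩
  · rw [Finsupp.single_apply]; split_ifs <;> norm_num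
  · rw [hs, Finset.mem_singleton] at hm
    exact hm.ge
  · simp

theorem half_add_mem_tailWeights {n : ℕ} {a b : ℕ →₀ ℝ} (ha : a ∈ tailWeights n)
    (hb : b ∈ tailWeights n) : (1 / 2 : ℝ) • (a + b) ∈ tailWeights n := by
  classical
  have hsum : ∀ c : ℕ →₀ ℝ, ∑ m ∈ c.support, c m = c.sum fun _ x => x := fun c => rfl
  refine ⟨fun m => ?_, fun m hm => ?_, ?_⟩
  · have := ha.1 m; have := hb.1 m
    simp only [Finsupp.smul_apply, Finsupp.add_apply, smul_eq_mul]; positivity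
  · have h1 := Finsupp.support_add (Finsupp.support_smul hm)
    rcases Finset.mem_union.1 h1 with h | h
    exacts [ha.2.1 m h, hb.2.1 m h]
  · rw [hsum, Finsupp.sum_smul_index' (fun _ => rfl)]
    have h2 : ((a + b).sum fun _ c => (1 / 2 : ℝ) • c) = (1 / 2 : ℝ) • (a + b).sum fun _ c => c :=
      (Finset.smul_sum).symm
    rw [h2, Finsupp.sum_add_index' (fun _ => rfl) (fun _ _ _ => rfl), ← hsum, ← hsum, ha.2.2,
      hb.2.2]
    norm_num

theorem tendsto_tailWeights {a : ℕ → ℕ →₀ ℝ} (ha : ∀ n, a n ∈ tailWeights n) {x : ℕ → ℝ} {l : ℝ}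
    (hx : Tendsto x atTop (𝓝 l)) :
    Tendsto (fun n => ∑ m ∈ (a n).support, a n m * x m) atTop (𝓝 l) := by
  rw [Metric.tendsto_atTop] at hx ⊢
  intro ε hε
  obtain ⟨N, hN⟩ := hx (ε / 2) (half_pos hε)
  refine ⟨N, fun n hn => lt_of_le_of_lt ?_ (half_lt_self hε)⟩
  have h1 : ∑ m ∈ (a n).support, a n m * x m - l = ∑ m ∈ (a n).support, a n m * (x m - l) := by
    simp only [mul_sub, Finset.sum_sub_distrib, ← Finset.sum_mul, (ha n).2.2, one_mul]
  rw [Real.dist_eq, h1]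
  calc |∑ m ∈ (a n).support, a n m * (x m - l)|
      ≤ ∑ m ∈ (a n).support, a n m * (ε / 2) := by
        refine (Finset.abs_sum_le_sum_abs _ _).trans (Finset.sum_le_sum fun m hm => ?_)
        rw [abs_mul, abs_of_nonneg ((ha n).1 m)]
        have := (hN m (hn.trans ((ha n).2.1 m hm))).le
        rw [Real.dist_eq] at this
        exact mul_le_mul_of_nonneg_left this ((ha n).1 m)
    _ = ε / 2 := by rw [← Finset.sum_mul, (ha n).2.2, one_mul]

/-- A bounded sequence in a Hilbert space has forward convex combinations that converge in norm:
almost minimal elements of the tail hulls form a Cauchy sequence by the parallelogram law. -/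
theorem exists_tailWeights_tendsto {E : Type*} [NormedAddCommGroup E] [InnerProductSpace ℝ E]
    [CompleteSpace E] {x : ℕ → E} {C : ℝ} (hx : ∀ n, ‖x n‖ ≤ C) :
    ∃ a : ℕ → ℕ →₀ ℝ, (∀ n, a n ∈ tailWeights n) ∧
      ∃ l, Tendsto (fun n => ∑ m ∈ (a n).support, a n m • x m) atTop (𝓝 l) := by
  set comb : (ℕ →₀ ℝ) →ₗ[ℝ] E := Finsupp.linearCombination ℝ x with hcomb
  have hca : ∀ a : ℕ →₀ ℝ, comb a = ∑ m ∈ a.support, a m • x m := fun a => rfl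
  set d : ℕ → ℝ := fun n => sInf ((fun a => ‖comb a‖) '' tailWeights n) with hd
  have hbdd : ∀ n, BddBelow ((fun a => ‖comb a‖) '' tailWeights n) := fun n =>
    ⟨0, by rintro _ ⟨a, -, rfl⟩; exact norm_nonneg _⟩
  have hne : ∀ n, ((fun a => ‖comb a‖) '' tailWeights n).Nonempty := fun n =>
    ⟨_, _, single_mem_tailWeights n, rfl⟩
  have hd0 : ∀ n, 0 ≤ d n := fun n => le_csInf (hne n) (by
    rintro _ ⟨a, -, rfl⟩; exact norm_nonneg _)
  have hdle : ∀ n a, a ∈ tailWeights n → d n ≤ ‖comb a‖ := fun n a ha =>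
    csInf_le (hbdd n) ⟨a, ha, rfl⟩
  have hdC : ∀ n, d n ≤ C := fun n => by
    refine (hdle n _ (single_mem_tailWeights n)).trans ?_
    simpa [hcomb] using hx n
  have hmono : Monotone d := fun k n hkn =>
    csInf_le_csInf (hbdd k) (hne n) (Set.image_mono (tailWeights_anti hkn))
  have hbA : BddAbove (Set.range d) := ⟨C, by rintro _ ⟨n, rfl⟩; exact hdC n⟩
  have hlim := tendsto_atTop_ciSup hmono hbA
  set D := ⨆ n, d n
  have hdD : ∀ n, d n ≤ D := le_ciSup hbA
  have hch : ∀ n : ℕ, ∃ a ∈ tailWeights n, ‖comb a‖ < d n + 1 / ((n : ℝ) + 1) := fun n => by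
    obtain ⟨_, ⟨a, ha, rfl⟩, h⟩ := exists_lt_of_csInf_lt (hne n)
      (show d n < d n + 1 / ((n : ℝ) + 1) from lt_add_of_pos_right _ (by positivity))
    exact ⟨a, ha, h⟩
  choose a ha hlt using hch
  refine ⟨a, ha, ?_⟩
  simp only [← hca]
  refine cauchySeq_tendsto_of_complete (cauchySeq_of_le_tendsto_0
    (fun k => √(4 * (D + 1 / ((k : ℝ) + 1)) ^ 2 - 4 * d k ^ 2)) ?_ ?_)
  · intro n m k hkn hkm
    have hb : ∀ n, k ≤ n → ‖comb (a n)‖ ≤ D + 1 / ((k : ℝ) + 1) := fun n hn =>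
      (hlt n).le.trans (add_le_add (hdD n) (Nat.one_div_le_one_div hn))
    have h1 := hdle k _ (half_add_mem_tailWeights (tailWeights_anti hkn (ha n))
      (tailWeights_anti hkm (ha m)))
    rw [map_smul, map_add, norm_smul] at h1
    have h2 := parallelogram_law_with_norm ℝ (comb (a n)) (comb (a m))
    have h3 := pow_le_pow_left₀ (norm_nonneg _) (hb n hkn) 2
    have h4 := pow_le_pow_left₀ (norm_nonneg _) (hb m hkm) 2
    have h5 := pow_le_pow_left₀ (hd0 k) h1 2
    rw [dist_eq_norm]
    refine Real.le_sqrt_of_sq_le ?_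
    have h6 : ‖(1 / 2 : ℝ)‖ = 1 / 2 := by norm_num
    rw [h6] at h5
    nlinarith
  · have h1 : Tendsto (fun k : ℕ => √(4 * (D + 1 / ((k : ℝ) + 1)) ^ 2 - 4 * d k ^ 2)) atTop
        (𝓝 √(4 * (D + 0) ^ 2 - 4 * D ^ 2)) :=
      ((((tendsto_const_nhds.add tendsto_one_div_add_atTop_nhds_zero_nat).pow 2).const_mul 4).sub
        ((hlim.pow 2).const_mul 4)).sqrt
    simpa using h1

variable {Ω : Type*} [mΩ : MeasurableSpace Ω] {P : Measure Ω} {D W : Set (Ω → ℝ)}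

/-- A set of claims is convexly compact if every sequence in it has forward convex combinations
that converge almost surely to an element of the set. -/
def ConvexlyCompact (P : Measure Ω) (W : Set (Ω → ℝ)) : Prop :=
  ∀ w : ℕ → Ω → ℝ, (∀ n, w n ∈ W) → ∃ a : ℕ → ℕ →₀ ℝ, (∀ n, a n ∈ tailWeights n) ∧
    ∃ w' ∈ W, ∀ᵐ ω ∂P,
      Tendsto (fun n => ∑ m ∈ (a n).support, a n m * w m ω) atTop (𝓝 (w' ω))

theorem convexlyCompact_singleton (w : Ω → ℝ) : ConvexlyCompact P {w} := by
  intro v hv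
  refine ⟨fun n => Finsupp.single n 1, single_mem_tailWeights, w, rfl, ae_of_all _ fun ω => ?_⟩
  refine tendsto_tailWeights single_mem_tailWeights ?_
  simp only [Set.mem_singleton_iff] at hv
  simp [hv]

theorem AEClosed.add_convexlyCompact (hD : Convex ℝ D) (hc : AEClosed P D)
    (hW : ConvexlyCompact P W) : AEClosed P {X | ∃ w ∈ W, X - w ∈ D} := by
  intro X X' hX hlim
  choose w hw hXw using hX
  obtain ⟨a, ha, w', hw', haw⟩ := hW w hw
  refine ⟨w', hw', hc (fun n => ∑ m ∈ (a n).support, a n m • (X m - w m)) _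
    (fun n => hD.sum_mem (fun m _ => (ha n).1 m) (ha n).2.2 fun m _ => hXw m) ?_⟩
  filter_upwards [hlim, haw] with ω h1 h2
  refine ((tendsto_tailWeights ha h1).sub h2).congr fun n => ?_
  simp [Finset.sum_apply, mul_sub, Finset.sum_sub_distrib]

/-- If `D` is a closed cone that contains no `-w` with `w ∈ W`, then adding nonnegative multiples
of elements of `W` keeps it closed: exploding multiples would produce such a `w` as a rescaled
limit. -/
theorem AEClosed.add_ray (hD : IsClaimCone ⊥ P D) (hc : AEClosed P D)
    (hW : ConvexlyCompact P W) {K : ℝ} (hK : ∀ w ∈ W, ∀ᵐ ω ∂P, |w ω| ≤ K)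
    (hno : ∀ w ∈ W, -w ∉ D) :
    AEClosed P {X | ∃ c : ℝ, 0 ≤ c ∧ ∃ w ∈ W, X - c • w ∈ D} := by
  intro X X' hX hlim
  choose c hc0 w hw hXw using hX
  by_cases hfreq : ∃ R, ∃ᶠ n in atTop, c n ∈ Set.Icc 0 R
  · obtain ⟨R, hR⟩ := hfreq
    obtain ⟨l, hl, s, hs, hcs⟩ := tendsto_subseq_of_frequently_bounded (Metric.isBounded_Icc 0 R) hR
    have hl0 : 0 ≤ l := ge_of_tendsto hcs (Eventually.of_forall fun n => hc0 (s n))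
    obtain ⟨a, ha, w', hw', haw⟩ := hW (fun n => w (s n)) fun n => hw _
    refine ⟨l, hl0, w', hw', hc
      (fun n => ∑ m ∈ (a n).support, a n m • (X (s m) - c (s m) • w (s m))) _
      (fun n => hD.convex.sum_mem (fun m _ => (ha n).1 m) (ha n).2.2 fun m _ => hXw _) ?_⟩
    have hb : ∀ᵐ ω ∂P, ∀ n, |w (s n) ω| ≤ K := ae_all_iff.2 fun n => hK _ (hw _)
    filter_upwards [hlim, haw, hb] with ω h1 h2 h3
    have h4 : Tendsto (fun m => (c (s m) - l) * w (s m) ω) atTop (𝓝 0) := by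
      have h5 : Tendsto (fun m => c (s m) - l) atTop (𝓝 0) := by
        have := hcs.sub_const l
        rwa [sub_self] at this
      refine bdd_le_mul_tendsto_zero' K (Eventually.of_forall h3) h5 |>.congr fun m => mul_comm _ _
    have h6 := ((tendsto_tailWeights ha (h1.comp hs.tendsto_atTop)).sub
      (tendsto_tailWeights ha h4)).sub (h2.const_mul l)
    rw [sub_zero] at h6
    refine h6.congr fun n => ?_
    simp only [Finset.sum_apply, Pi.smul_apply, Pi.sub_apply, smul_eq_mul, Function.comp,
      Finset.mul_sum, ← Finset.sum_sub_distrib]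
    exact Finset.sum_congr rfl fun m _ => by ring
  · have htop : Tendsto c atTop atTop := by
      refine tendsto_atTop.2 fun R => ?_
      simp only [not_exists, not_frequently] at hfreq
      filter_upwards [hfreq R] with n hn
      by_contra h
      exact hn ⟨hc0 n, (not_le.1 h).le⟩
    obtain ⟨a, ha, w', hw', haw⟩ := hW w hw
    refine absurd (hc (fun n => ∑ m ∈ (a n).support, a n m • ((c m)⁻¹ • (X m - c m • w m))) _
      (fun n => hD.convex.sum_mem (fun m _ => (ha n).1 m) (ha n).2.2 fun m _ =>
        hD.smul_mem (inv_nonneg.2 (hc0 m)) (hXw m)) ?_) (hno w' hw')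
    filter_upwards [hlim, haw] with ω h1 h2
    have h3 : Tendsto (fun m => (c m)⁻¹ * (X m ω - c m * w m ω) + w m ω) atTop (𝓝 0) := by
      have h4 := (tendsto_inv_atTop_zero.comp htop).mul h1
      rw [zero_mul] at h4
      refine h4.congr' ?_
      filter_upwards [htop.eventually_gt_atTop 0] with m hm
      simp only [Function.comp]
      field_simp
      ring
    have h5 := (tendsto_tailWeights ha h3).sub h2
    rw [zero_sub] at h5
    refine h5.congr fun n => ?_
    simp only [Finset.sum_apply, Pi.smul_apply, Pi.sub_apply, smul_eq_mul,
      ← Finset.sum_sub_distrib]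
    exact Finset.sum_congr rfl fun m _ => by ring

/-- Liquidating strategies are sequentially compact up to forward convex combinations. -/
theorem IsLiquidating.exists_tailWeights [IsProbabilityMeasure P] {T : ℕ}
    {ℱ : Filtration (Fin (T + 1)) mΩ} {η : ℕ → Fin (T + 1) → Ω → ℝ}
    (hη : ∀ n, IsLiquidating ℱ P (η n)) :
    ∃ a : ℕ → ℕ →₀ ℝ, (∀ n, a n ∈ tailWeights n) ∧ ∃ η', IsLiquidating ℱ P η' ∧
      ∀ᵐ ω ∂P, ∀ t,
        Tendsto (fun n => ∑ m ∈ (a n).support, a n m * η m t ω) atTop (𝓝 (η' t ω)) := by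
  classical
  set F : ℕ → Ω → EuclideanSpace ℝ (Fin (T + 1)) := fun n ω => WithLp.toLp 2 fun t => η n t ω
    with hF
  have hle : ∀ n, ∀ᵐ ω ∂P, ‖F n ω‖ ≤ 1 := fun n => by
    filter_upwards [(hη n).sum_eq_one] with ω hω
    rw [EuclideanSpace.norm_eq]
    refine Real.sqrt_le_one.2 ?_
    calc ∑ t, ‖(F n ω) t‖ ^ 2 ≤ ∑ t, η n t ω := Finset.sum_le_sum fun t _ => by
          have h0 := (hη n).nonneg t ω
          have h1 : η n t ω ≤ 1 := hω ▸ Finset.single_le_sum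
            (fun s _ => (hη n).nonneg s ω) (Finset.mem_univ t)
          simp only [hF, Real.norm_eq_abs, sq_abs]
          nlinarith
      _ = 1 := hω
  have hFm : ∀ n, AEStronglyMeasurable (F n) P := fun n => by
    refine Measurable.aestronglyMeasurable ?_
    refine (WithLp.measurable_toLp 2 _).comp (measurable_pi_lambda _ fun t => ?_)
    exact ((hη n).adapted t).mono (ℱ.le t) le_rfl
  have hFL : ∀ n, MemLp (F n) 2 P := fun n => MemLp.of_bound (hFm n) 1 (hle n)
  obtain ⟨a, ha, l, hl⟩ := exists_tailWeights_tendsto (x := fun n => (hFL n).toLp (F n)) (C := _)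
    fun n => Lp.norm_le_of_ae_bound (f := (hFL n).toLp (F n)) zero_le_one (by
      filter_upwards [hle n, (hFL n).coeFn_toLp] with ω h1 h2
      rwa [h2])
  have hcoe : ∀ b : ℕ →₀ ℝ, (⇑(∑ m ∈ b.support, b m • (hFL m).toLp (F m)) : Ω → _)
      =ᵐ[P] fun ω => ∑ m ∈ b.support, b m • F m ω := fun b => by
    generalize b.support = s
    induction s using Finset.induction_on with
    | empty =>
      simp only [Finset.sum_empty]
      exact Lp.coeFn_zero _ 2 P
    | insert i s hi ih =>
      rw [Finset.sum_insert hi]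
      filter_upwards [Lp.coeFn_add (b i • (hFL i).toLp (F i))
        (∑ m ∈ s, b m • (hFL m).toLp (F m)), ih, Lp.coeFn_smul (b i) ((hFL i).toLp (F i)),
        (hFL i).coeFn_toLp] with ω h1 h2 h3 h4
      rw [h1, Pi.add_apply, h2, h3, Pi.smul_apply, h4, Finset.sum_insert hi]
  obtain ⟨s, hs, hae⟩ := (tendstoInMeasure_of_tendsto_Lp hl).exists_seq_tendsto_ae
  set comb : ℕ → Fin (T + 1) → Ω → ℝ := fun n t ω =>
    ∑ m ∈ (a (s n)).support, a (s n) m * η m t ω with hcombdef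
  have hconv : ∀ᵐ ω ∂P, ∀ t, Tendsto (fun n => comb n t ω) atTop (𝓝 (l ω t)) := by
    filter_upwards [hae, ae_all_iff.2 fun n => hcoe (a (s n))] with ω h1 h2 t
    have h3 := ((EuclideanSpace.proj (𝕜 := ℝ) t).continuous.tendsto (l ω)).comp h1
    refine h3.congr fun n => ?_
    simp only [Function.comp]
    rw [h2 n]
    simp [hcombdef, hF]
  have hsum : ∀ᵐ ω ∂P, ∀ n, ∑ t, comb n t ω = 1 := by
    filter_upwards [ae_all_iff.2 fun n => (hη n).sum_eq_one] with ω h n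
    simp only [hcombdef]
    rw [Finset.sum_comm]
    simp only [← Finset.mul_sum, h, mul_one, (ha (s n)).2.2]
  have hcomb0 : ∀ n t ω, 0 ≤ comb n t ω := fun n t ω =>
    Finset.sum_nonneg fun m _ => mul_nonneg ((ha _).1 m) ((hη m).nonneg t ω)
  -- the upper limit is an adapted version of the limit
  refine ⟨fun n => a (s n), fun n => tailWeights_anti (hs.id_le n) (ha (s n)),
    fun t ω => max (limsup (fun n => comb n t ω) atTop) 0, ⟨fun t => ?_, fun t ω =>
    le_max_right _ _, ?_⟩, ?_⟩
  · refine (Measurable.limsup fun n => ?_).max measurable_const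
    exact Finset.measurable_fun_sum _ fun m _ => ((hη m).adapted t).const_mul _
  · filter_upwards [hconv, hsum] with ω h1 h2
    have h3 : ∀ t, max (limsup (fun n => comb n t ω) atTop) 0 = l ω t := fun t => by
      rw [(h1 t).limsup_eq]
      exact max_eq_left (ge_of_tendsto' (h1 t) fun n => hcomb0 n t ω)
    simp only [h3]
    exact tendsto_nhds_unique (tendsto_finsetSum _ fun t _ => h1 t) (by simp [h2])
  · filter_upwards [hconv] with ω h1 t
    rw [(h1 t).limsup_eq, max_eq_left (ge_of_tendsto' (h1 t) fun n => hcomb0 n t ω)]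
    exact h1 t

theorem convexlyCompact_liquidate [IsProbabilityMeasure P] {T : ℕ}
    {ℱ : Filtration (Fin (T + 1)) mΩ} (φ : Fin (T + 1) → Ω → ℝ) (q : ℝ) :
    ConvexlyCompact P {w | ∃ η, IsLiquidating ℱ P η ∧ w = fun ω => liquidate η φ ω - q} := by
  intro w hw
  choose η hη hwη using hw
  obtain ⟨a, ha, η', hη', hlim⟩ := IsLiquidating.exists_tailWeights hη
  refine ⟨a, ha, _, ⟨η', hη', rfl⟩, ?_⟩
  filter_upwards [hlim] with ω h
  have h1 : Tendsto (fun n => ∑ t, φ t ω * (∑ m ∈ (a n).support, a n m * η m t ω) - q) atTop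
      (𝓝 (∑ t, φ t ω * η' t ω - q)) :=
    (tendsto_finsetSum _ fun t _ => (h t).const_mul _).sub_const q
  refine h1.congr fun n => ?_
  simp only [hwη, liquidate, mul_sub, Finset.sum_sub_distrib, ← Finset.sum_mul, (ha n).2.2,
    one_mul, Finset.mul_sum]
  rw [Finset.sum_comm]
  congr 1
  exact Finset.sum_congr rfl fun m _ => Finset.sum_congr rfl fun t _ => by ring

theorem IsLiquidating.abs_liquidate_le {T : ℕ} {ℱ : Filtration (Fin (T + 1)) mΩ}
    {η φ : Fin (T + 1) → Ω → ℝ} {K : ℝ} (hη : IsLiquidating ℱ P η)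
    (hφ : ∀ t ω, |φ t ω| ≤ K) : ∀ᵐ ω ∂P, |liquidate η φ ω| ≤ K := by
  filter_upwards [hη.sum_eq_one] with ω h
  calc |liquidate η φ ω| ≤ ∑ t, K * η t ω := by
        refine (Finset.abs_sum_le_sum_abs _ _).trans (Finset.sum_le_sum fun t _ => ?_)
        rw [abs_mul, abs_of_nonneg (hη.nonneg t ω)]
        exact mul_le_mul_of_nonneg_right (hφ t ω) (hη.nonneg t ω)
    _ = K := by rw [← Finset.mul_sum, h, mul_one]

end SemiStatic

/-! ### The cone of superreplicable claims -/

namespace SemiStatic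

variable {Ω : Type*} [mΩ : MeasurableSpace Ω] {P : Measure Ω} {D W : Set (Ω → ℝ)}

omit mΩ in
theorem exists_eq_const_of_measurable_bot {H : Ω → ℝ} (hH : Measurable[⊥] H) :
    ∃ c : ℝ, H = fun _ => c := by
  have h : StronglyMeasurable[⊥] H := hH.stronglyMeasurable
  exact stronglyMeasurable_bot_iff.1 h

/-- The claims obtained from `D` by additionally buying nonnegative quantities `c k` of claims
`w k` that may be chosen from the sets `W k`, `k ∈ s`. -/
def optionCone {κ : Type*} (D : Set (Ω → ℝ)) (W : κ → Set (Ω → ℝ)) (s : Finset κ) :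
    Set (Ω → ℝ) :=
  {X | ∃ (c : κ → ℝ) (w : κ → Ω → ℝ), (∀ k, 0 ≤ c k) ∧ (∀ k, w k ∈ W k) ∧
    X - ∑ k ∈ s, c k • w k ∈ D}

theorem IsClaimCone.optionCone {κ : Type*} (hD : IsClaimCone ⊥ P D) {W : κ → Set (Ω → ℝ)}
    (hconv : ∀ k, Convex ℝ (W k)) (hne : ∀ k, (W k).Nonempty) (s : Finset κ) :
    IsClaimCone ⊥ P (optionCone D W s) where
  zero_mem := ⟨fun _ => 0, fun k => (hne k).some, fun _ => le_rfl, fun k => (hne k).some_mem, by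
    simpa using hD.zero_mem⟩
  add_mem := by
    rintro X Y ⟨c, w, hc, hw, hX⟩ ⟨c', w', hc', hw', hY⟩
    have hex : ∀ k, ∃ v ∈ W k, (c k + c' k) • v = c k • w k + c' k • w' k := fun k => by
      rcases (add_nonneg (hc k) (hc' k)).eq_or_lt with h | h
      · have h1 : c k = 0 := by linarith [hc k, hc' k]
        have h2 : c' k = 0 := by linarith [hc k, hc' k]
        exact ⟨w k, hw k, by simp [h1, h2]⟩
      · refine ⟨(c k / (c k + c' k)) • w k + (c' k / (c k + c' k)) • w' k,
          hconv k (hw k) (hw' k) (div_nonneg (hc k) h.le) (div_nonneg (hc' k) h.le)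
            (by rw [← add_div, div_self h.ne']), ?_⟩
        rw [smul_add, smul_smul, smul_smul, mul_div_cancel₀ _ h.ne', mul_div_cancel₀ _ h.ne']
    choose v hv hcv using hex
    refine ⟨fun k => c k + c' k, v, fun k => add_nonneg (hc k) (hc' k), hv, ?_⟩
    simp only [hcv, Finset.sum_add_distrib]
    convert hD.add_mem hX hY using 1
    abel
  mul_mem := by
    rintro H X hH hH0 ⟨c, w, hc, hw, hX⟩
    obtain ⟨a, rfl⟩ := exists_eq_const_of_measurable_bot hH
    rcases isEmpty_or_nonempty Ω with hΩ | ⟨⟨ω₀⟩⟩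
    · exact ⟨c, w, hc, hw, by convert hX using 1⟩
    refine ⟨fun k => a * c k, w, fun k => mul_nonneg (hH0 ω₀) (hc k), hw, ?_⟩
    convert hD.smul_mem (hH0 ω₀) hX using 1
    simp only [mul_smul, smul_sub, Finset.smul_sum]
    rfl
  mono := by
    rintro X Y ⟨c, w, hc, hw, hX⟩ hYX
    refine ⟨c, w, hc, hw, hD.mono hX ?_⟩
    filter_upwards [hYX] with ω h
    exact sub_le_sub_right h _

theorem aeClosed_optionCone {κ : Type*} [Fintype κ] (hD : IsClaimCone ⊥ P D)
    (hcl : AEClosed P D) {W : κ → Set (Ω → ℝ)} (hconv : ∀ k, Convex ℝ (W k))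
    (hne : ∀ k, (W k).Nonempty) (hcomp : ∀ k, ConvexlyCompact P (W k))
    (hbdd : ∀ k, ∃ K : ℝ, ∀ w ∈ W k, ∀ᵐ ω ∂P, |w ω| ≤ K)
    (hno : ∀ k, ∀ w ∈ W k, -w ∉ optionCone D W Finset.univ) (s : Finset κ) :
    AEClosed P (optionCone D W s) := by
  classical
  induction s using Finset.induction_on with
  | empty =>
    intro X Y hX hlim
    refine ⟨fun _ => 0, fun k => (hne k).some, fun _ => le_rfl, fun k => (hne k).some_mem, ?_⟩
    rw [Finset.sum_empty, sub_zero]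
    refine hcl X Y (fun n => ?_) hlim
    obtain ⟨c, w, -, -, h⟩ := hX n
    simpa using h
  | insert i s hi ih =>
    obtain ⟨K, hK⟩ := hbdd i
    have hray := ih.add_ray (hD.optionCone hconv hne s) (hcomp i) hK ?_
    · convert hray using 1
      ext X
      constructor
      · rintro ⟨c, w, hc, hw, hX⟩
        refine ⟨c i, hc i, w i, hw i, c, w, hc, hw, ?_⟩
        rwa [Finset.sum_insert hi, ← sub_sub] at hX
      · rintro ⟨a, ha, v, hv, c, w, hc, hw, hX⟩
        refine ⟨Function.update c i a, Function.update w i v, fun k => ?_, fun k => ?_, ?_⟩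
        · rcases eq_or_ne k i with rfl | h
          · simpa using ha
          · simpa [h] using hc k
        · rcases eq_or_ne k i with rfl | h
          · simpa using hv
          · simpa [h] using hw k
        · rw [Finset.sum_insert hi, Function.update_self, Function.update_self, ← sub_sub]
          convert hX using 2
          refine Finset.sum_congr rfl fun k hk => ?_
          rw [Function.update_of_ne (ne_of_mem_of_not_mem hk hi),
            Function.update_of_ne (ne_of_mem_of_not_mem hk hi)]
    · rintro v hv ⟨c, w, hc, hw, hX⟩
      refine hno i v hv ⟨fun k => if k ∈ s then c k else 0, w, fun k => ?_, hw, ?_⟩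
      · dsimp only
        split_ifs
        exacts [hc k, le_rfl]
      · simpa [ite_smul, Finset.sum_ite_mem] using hX

namespace Market

variable {T d L M N : ℕ}

/-- The instruments that are traded in both directions: the options `f`, and each stock over each
period. -/
def asset (mkt : Market Ω T d L M N) : Fin L ⊕ (Fin T × Fin d) → Ω → ℝ
  | Sum.inl i => fun ω => mkt.f i ω - mkt.fbar i
  | Sum.inr (t, i) => fun ω => mkt.S t.succ ω i - mkt.S t.castSucc ω i

/-- The information on which the volume traded of an instrument may depend. -/
abbrev assetInfo (mkt : Market Ω T d L M N) : Fin L ⊕ (Fin T × Fin d) → MeasurableSpace Ω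
  | Sum.inl _ => ⊥
  | Sum.inr (t, _) => mkt.ℱ t.castSucc

/-- The instruments in the order of their trading dates. -/
def assetRank : Fin L ⊕ (Fin T × Fin d) → ℕ :=
  Sum.elim (fun _ => 0) fun ti => (ti.1 : ℕ) + 1

theorem assetInfo_mono {mkt : Market Ω T d L M N} (i j : Fin L ⊕ (Fin T × Fin d))
    (h : assetRank i ≤ assetRank j) : mkt.assetInfo i ≤ mkt.assetInfo j := by
  rcases i with i | ⟨t, i⟩ <;> rcases j with j | ⟨u, j⟩
  · exact le_rfl
  · exact bot_le
  · simp [assetRank] at h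
  · refine mkt.ℱ.mono ?_
    simp only [assetRank, Sum.elim_inr] at h
    rw [Fin.castSucc_le_castSucc_iff, Fin.le_def]
    omega

/-- The net payoffs obtainable from one unit of an option `g` or `h`. -/
def optionPayoffs (mkt : Market Ω T d L M N) (P : Measure Ω) (pg : Fin M → ℝ) (ph : Fin N → ℝ) :
    Fin M ⊕ Fin N → Set (Ω → ℝ)
  | Sum.inl j => {fun ω => mkt.g j ω - pg j}
  | Sum.inr k => {w | ∃ η, IsLiquidating mkt.ℱ P η ∧ w = fun ω => liquidate η (mkt.h k) ω - ph k}

/-- The claims that can be superreplicated at zero cost by a semi-static strategy. -/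
def hedgeCone (mkt : Market Ω T d L M N) (P : Measure Ω) (pg : Fin M → ℝ) (ph : Fin N → ℝ) :
    Set (Ω → ℝ) :=
  {X | ∃ s, mkt.Admissible P s ∧ X ≤ᵐ[P] mkt.terminalValue pg ph s}

variable {mkt : Market Ω T d L M N} {pg : Fin M → ℝ} {ph : Fin N → ℝ}

theorem hedgeCone_eq : mkt.hedgeCone P pg ph =
    optionCone (tradingCone P mkt.assetInfo mkt.asset Finset.univ) (mkt.optionPayoffs P pg ph)
      Finset.univ := by
  ext X
  constructor
  · rintro ⟨s, hs, hX⟩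
    refine ⟨Sum.elim s.b s.c, Sum.elim (fun j ω => mkt.g j ω - pg j)
      (fun k ω => liquidate (s.μ k) (mkt.h k) ω - ph k), ?_, ?_,
      Sum.elim (fun i _ => s.a i) (fun ti ω => s.H ti.1.castSucc ω ti.2), ?_, ?_⟩
    · rintro (j | k)
      exacts [hs.b_nonneg j, hs.c_nonneg k]
    · rintro (j | k)
      exacts [rfl, ⟨s.μ k, hs.liquidating k, rfl⟩]
    · rintro (i | ⟨t, i⟩)
      · exact measurable_const
      · exact (measurable_pi_apply i).comp (hs.adapted_H t.castSucc)
    · filter_upwards [hX] with ω h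
      simp only [terminalValue, stockGain] at h
      simp only [Pi.sub_apply, Pi.add_apply, Finset.sum_apply, Pi.smul_apply, smul_eq_mul,
        Fintype.sum_sum_type, Fintype.sum_prod_type, Sum.elim_inl, Sum.elim_inr, asset]
      linarith
  · rintro ⟨c, w, hc, hw, H, hH, hX⟩
    choose a ha using fun i => exists_eq_const_of_measurable_bot (hH (Sum.inl i))
    choose μ hμ hwμ using fun k => hw (Sum.inr k)
    refine ⟨⟨fun t => Fin.lastCases (fun _ _ => 0) (fun t ω i => H (Sum.inr (t, i)) ω) t, a,
      fun j => c (Sum.inl j), fun k => c (Sum.inr k), μ⟩,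
      ⟨fun t => ?_, fun _ => hc _, fun _ => hc _, hμ⟩, ?_⟩
    · refine Fin.lastCases ?_ (fun t => ?_) t
      · simp only [Fin.lastCases_last]
        exact measurable_const
      · simp only [Fin.lastCases_castSucc]
        exact @measurable_pi_lambda _ _ _ (mkt.ℱ t.castSucc) _ _ fun i => hH (Sum.inr (t, i))
    · filter_upwards [hX] with ω h
      have hwg : ∀ j, w (Sum.inl j) = fun ω => mkt.g j ω - pg j := fun j => hw (Sum.inl j)
      simp only [Pi.sub_apply, Pi.add_apply, Finset.sum_apply, Pi.smul_apply, smul_eq_mul, hwg, hwμ,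
        ha, Fintype.sum_sum_type, Fintype.sum_prod_type, asset] at h
      simp only [terminalValue, stockGain, Fin.lastCases_castSucc]
      linarith

end Market

theorem convex_setOf_isLiquidating {T : ℕ} {ℱ : Filtration (Fin (T + 1)) mΩ} :
    Convex ℝ {η | IsLiquidating ℱ P η} := by
  intro η hη η' hη' a b ha hb hab
  refine ⟨fun t => ((hη.adapted t).const_mul a).add ((hη'.adapted t).const_mul b), fun t ω =>
    add_nonneg (mul_nonneg ha (hη.nonneg t ω)) (mul_nonneg hb (hη'.nonneg t ω)), ?_⟩
  filter_upwards [hη.sum_eq_one, hη'.sum_eq_one] with ω h h'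
  simp [Finset.sum_add_distrib, ← Finset.mul_sum, h, h', hab]

theorem isLiquidating_stop {T : ℕ} {ℱ : Filtration (Fin (T + 1)) mΩ} {τ : Ω → Fin (T + 1)}
    (hτ : τ ∈ stoppingTimes ℱ) : IsLiquidating ℱ P fun t ω => if τ ω = t then 1 else 0 := by
  classical
  refine ⟨fun t => ?_, fun t ω => ?_, ae_of_all _ fun ω => by simp⟩
  · refine Measurable.ite ?_ measurable_const measurable_const
    have := IsStoppingTime.measurableSet_eq hτ t
    convert this using 1
    ext ω
    simp
  · split_ifs <;> norm_num

omit mΩ in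
theorem liquidate_stop {T : ℕ} (τ : Ω → Fin (T + 1)) (φ : Fin (T + 1) → Ω → ℝ) (ω : Ω) :
    liquidate (fun t ω => if τ ω = t then 1 else 0) φ ω = φ (τ ω) ω := by
  simp [liquidate]

theorem const_mem_stoppingTimes {T : ℕ} (ℱ : Filtration (Fin (T + 1)) mΩ) (t : Fin (T + 1)) :
    (fun _ => t) ∈ stoppingTimes ℱ :=
  isStoppingTime_const ℱ t

theorem exists_isLiquidating {T : ℕ} (P : Measure Ω) (ℱ : Filtration (Fin (T + 1)) mΩ) :
    ∃ η, IsLiquidating ℱ P η :=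
  ⟨_, isLiquidating_stop (const_mem_stoppingTimes ℱ 0)⟩

theorem convex_liquidate {T : ℕ} {ℱ : Filtration (Fin (T + 1)) mΩ} (φ : Fin (T + 1) → Ω → ℝ)
    (q : ℝ) : Convex ℝ {w | ∃ η, IsLiquidating ℱ P η ∧ w = fun ω => liquidate η φ ω - q} := by
  rintro _ ⟨η, hη, rfl⟩ _ ⟨η', hη', rfl⟩ a b ha hb hab
  refine ⟨_, convex_setOf_isLiquidating hη hη' ha hb hab, ?_⟩
  ext ω
  simp only [Pi.add_apply, Pi.smul_apply, smul_eq_mul, liquidate, mul_add, Finset.sum_add_distrib,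
    mul_left_comm _ a, mul_left_comm _ b, ← Finset.mul_sum]
  linear_combination (-q) * hab

namespace Market

variable {T d L M N : ℕ} {mkt : Market Ω T d L M N} {pg : Fin M → ℝ} {ph : Fin N → ℝ}

theorem convex_optionPayoffs (i : Fin M ⊕ Fin N) : Convex ℝ (mkt.optionPayoffs P pg ph i) := by
  rcases i with j | k
  exacts [convex_singleton _, convex_liquidate _ _]

theorem optionPayoffs_nonempty (i : Fin M ⊕ Fin N) :
    (mkt.optionPayoffs P pg ph i).Nonempty := by
  rcases i with j | k
  · exact Set.singleton_nonempty _
  · obtain ⟨η, hη⟩ := exists_isLiquidating P mkt.ℱ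
    exact ⟨_, η, hη, rfl⟩

theorem isClaimCone_hedgeCone : IsClaimCone ⊥ P (mkt.hedgeCone P pg ph) := by
  rw [hedgeCone_eq]
  exact (isClaimCone_tradingCone fun _ _ => bot_le).optionCone convex_optionPayoffs
    optionPayoffs_nonempty _

theorem NA.eq_zero (hNA : mkt.NA P pg ph) {X : Ω → ℝ} (hX : X ∈ mkt.hedgeCone P pg ph)
    (h0 : 0 ≤ᵐ[P] X) : X =ᵐ[P] 0 := by
  obtain ⟨s, hs, hXs⟩ := hX
  filter_upwards [h0, hXs, hNA s hs (h0.trans hXs)] with ω h1 h2 h3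
  exact le_antisymm (h2.trans_eq h3) h1

theorem tradingCone_subset_hedgeCone :
    tradingCone P mkt.assetInfo mkt.asset Finset.univ ⊆ mkt.hedgeCone P pg ph := by
  intro X hX
  rw [hedgeCone_eq]
  exact ⟨fun _ => 0, fun k => (optionPayoffs_nonempty k).some, fun _ => le_rfl,
    fun k => (optionPayoffs_nonempty k).some_mem, by simpa using hX⟩

theorem optionPayoffs_subset_hedgeCone (i : Fin M ⊕ Fin N) :
    mkt.optionPayoffs P pg ph i ⊆ mkt.hedgeCone P pg ph := by
  classical
  intro w hw
  rw [hedgeCone_eq]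
  refine ⟨Pi.single i 1, Function.update
    (fun k => (optionPayoffs_nonempty (mkt := mkt) (P := P) (pg := pg) (ph := ph) k).some) i w,
    fun k => ?_, fun k => ?_, ?_⟩
  · rcases eq_or_ne k i with rfl | h
    · simp
    · simp [h]
  · rcases eq_or_ne k i with rfl | h
    · simpa using hw
    · simpa [h] using (optionPayoffs_nonempty k).some_mem
  · rw [Finset.sum_eq_single i (fun k _ h => by simp [h]) (by simp)]
    simpa using (isClaimCone_tradingCone (P := P) (G' := ⊥) fun _ _ => bot_le).zero_mem

theorem hedgeCone_anti {pg' : Fin M → ℝ} {ph' : Fin N → ℝ} (hg : ∀ j, pg' j ≤ pg j)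
    (hh : ∀ k, ph' k ≤ ph k) : mkt.hedgeCone P pg ph ⊆ mkt.hedgeCone P pg' ph' := by
  rintro X ⟨s, hs, hX⟩
  refine ⟨s, hs, hX.trans (ae_of_all _ fun ω => ?_)⟩
  simp only [terminalValue]
  gcongr with j _ k _
  · exact hs.b_nonneg j
  · exact hg j
  · exact hs.c_nonneg k
  · exact hh k

theorem exists_add_mem_optionPayoffs {εg : Fin M → ℝ} {εh : Fin N → ℝ}
    (hεg : ∀ j, 0 < εg j) (hεh : ∀ k, 0 < εh k) (i : Fin M ⊕ Fin N) :
    ∃ ε : ℝ, 0 < ε ∧ ∀ w ∈ mkt.optionPayoffs P pg ph i, (fun ω => w ω + ε) ∈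
      mkt.optionPayoffs P (fun j => pg j - εg j) (fun k => ph k - εh k) i := by
  rcases i with j | k
  · refine ⟨εg j, hεg j, ?_⟩
    rintro _ rfl
    exact funext fun ω => by ring
  · refine ⟨εh k, hεh k, ?_⟩
    rintro _ ⟨η, hη, rfl⟩
    exact ⟨η, hη, funext fun ω => by ring⟩

theorem exists_bound_optionPayoffs (mkt : Market Ω T d L M N) (P : Measure Ω) (pg : Fin M → ℝ)
    (ph : Fin N → ℝ) (i : Fin M ⊕ Fin N) :
    ∃ K : ℝ, ∀ w ∈ mkt.optionPayoffs P pg ph i, ∀ᵐ ω ∂P, |w ω| ≤ K := by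
  rcases i with j | k
  · obtain ⟨K, hK⟩ := mkt.bounded_g
    refine ⟨K + |pg j|, ?_⟩
    rintro _ rfl
    exact ae_of_all _ fun ω => (abs_sub _ _).trans (by gcongr; exact hK j ω)
  · obtain ⟨K, hK⟩ := mkt.bounded_h
    refine ⟨K + |ph k|, ?_⟩
    rintro _ ⟨η, hη, rfl⟩
    filter_upwards [hη.abs_liquidate_le (hK k)] with ω h
    exact (abs_sub _ _).trans (by gcongr)

/-- If there is no arbitrage even when all prices of `g` and `h` are lowered by positive amounts,
then the cone of superreplicable claims is closed. -/
theorem aeClosed_hedgeCone [IsProbabilityMeasure P] {εg : Fin M → ℝ} {εh : Fin N → ℝ}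
    (hεg : ∀ j, 0 < εg j) (hεh : ∀ k, 0 < εh k)
    (hNA : mkt.NA P (fun j => pg j - εg j) (fun k => ph k - εh k)) :
    AEClosed P (mkt.hedgeCone P pg ph) := by
  rw [hedgeCone_eq]
  refine aeClosed_optionCone (isClaimCone_tradingCone fun _ _ => bot_le)
    (aeClosed_tradingCone assetRank assetInfo_mono ?_ _)
    convex_optionPayoffs optionPayoffs_nonempty ?_ (exists_bound_optionPayoffs mkt P pg ph) ?_ _
  · intro H hH h0
    exact hNA.eq_zero (tradingCone_subset_hedgeCone ⟨H, hH, EventuallyLE.rfl⟩) h0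
  · rintro (j | k)
    exacts [convexlyCompact_singleton _, convexlyCompact_liquidate _ _]
  · -- a superreplicated `-w`, together with `w` bought at the lowered price, earns `ε > 0`
    intro i w hw hneg
    rw [← hedgeCone_eq] at hneg
    obtain ⟨ε, hε0, hε⟩ := exists_add_mem_optionPayoffs (P := P) (mkt := mkt) hεg hεh i
    have hmem := isClaimCone_hedgeCone.add_mem
      (hedgeCone_anti (fun j => (sub_le_self _ (hεg j).le))
        (fun k => (sub_le_self _ (hεh k).le)) hneg)
      (optionPayoffs_subset_hedgeCone i (hε w hw))
    have hz := hNA.eq_zero hmem (ae_of_all _ fun ω => by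
      simp only [Pi.zero_apply, Pi.add_apply, Pi.neg_apply]; linarith)
    obtain ⟨ω, hω⟩ := hz.exists
    simp only [Pi.zero_apply, Pi.add_apply, Pi.neg_apply] at hω
    linarith

end Market

end SemiStatic

/-! ### Separation and strictly positive densities in `L²` -/

namespace SemiStatic

variable {Ω : Type*} [mΩ : MeasurableSpace Ω] {P ν : Measure Ω} {D W : Set (Ω → ℝ)}

theorem Lp_inner_eq_integral (z x : Lp ℝ 2 ν) : inner ℝ z x = ∫ ω, z ω * x ω ∂ν := by
  rw [L2.inner_def]
  exact integral_congr_ae (ae_of_all _ fun ω => by simp [mul_comm])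

/-- Hahn–Banach in `L²`: a claim outside a convex set of claims that is closed and allows throwing
money away is separated from it by a nonnegative density. -/
theorem exists_nonneg_separating [IsFiniteMeasure ν] (hconv : Convex ℝ D) (hcl : AEClosed ν D)
    (hmono : ∀ {X Y : Ω → ℝ}, X ∈ D → Y ≤ᵐ[ν] X → Y ∈ D) {x₀ : Lp ℝ 2 ν}
    (hx₀ : (x₀ : Ω → ℝ) ∈ D) {y : Lp ℝ 2 ν} (hy : (y : Ω → ℝ) ∉ D) :
    ∃ z : Lp ℝ 2 ν, 0 ≤ z ∧ ∃ u : ℝ, (∀ x : Lp ℝ 2 ν, (x : Ω → ℝ) ∈ D → inner ℝ z x < u) ∧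
      u < inner ℝ z y := by
  have hcv : Convex ℝ {x : Lp ℝ 2 ν | (x : Ω → ℝ) ∈ D} := by
    intro x hx x' hx' a b ha hb hab
    refine hmono (hconv hx hx' ha hb hab) ?_
    filter_upwards [Lp.coeFn_add (a • x) (b • x'), Lp.coeFn_smul a x, Lp.coeFn_smul b x']
      with ω h1 h2 h3
    rw [h1, Pi.add_apply, h2, h3]
    rfl
  have hclosed : IsClosed {x : Lp ℝ 2 ν | (x : Ω → ℝ) ∈ D} := by
    refine IsSeqClosed.isClosed fun x x' hx hlim => ?_
    obtain ⟨s, -, hs⟩ := (tendstoInMeasure_of_tendsto_Lp hlim).exists_seq_tendsto_ae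
    exact hcl (fun n => x (s n)) _ (fun n => hx _) hs
  obtain ⟨f, u, hf, hu⟩ := geometric_hahn_banach_closed_point hcv hclosed hy
  set z := (InnerProductSpace.toDual ℝ (Lp ℝ 2 ν)).symm f with hz
  have hzf : ∀ x, inner ℝ z x = f x := fun x => InnerProductSpace.toDual_symm_apply
  refine ⟨z, ?_, u, fun x hx => by rw [hzf]; exact hf x hx, by rwa [hzf]⟩
  rw [← Lp.coeFn_nonneg]
  refine ae_nonneg_of_forall_setIntegral_nonneg ((Lp.memLp z).integrable one_le_two)
    fun s hs hsf => ?_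
  by_contra! hneg
  set e : Lp ℝ 2 ν := indicatorConstLp 2 hs hsf.ne 1 with he
  have hmem : ∀ n : ℕ, ((x₀ - (n : ℝ) • e : Lp ℝ 2 ν) : Ω → ℝ) ∈ D := fun n => by
    refine hmono hx₀ ?_
    filter_upwards [Lp.coeFn_sub x₀ ((n : ℝ) • e), Lp.coeFn_smul (n : ℝ) e,
      indicatorConstLp_coeFn (p := 2) (hs := hs) (hμs := hsf.ne) (c := (1 : ℝ))] with ω h1 h2 h3
    rw [h1, Pi.sub_apply, h2, Pi.smul_apply, h3]
    have : 0 ≤ s.indicator (fun _ => (1 : ℝ)) ω := Set.indicator_nonneg (fun _ _ => zero_le_one) ω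
    have : 0 ≤ (n : ℝ) • s.indicator (fun _ => (1 : ℝ)) ω := smul_nonneg n.cast_nonneg this
    linarith
  have hei : inner ℝ z e = ∫ ω in s, z ω ∂ν := by
    rw [real_inner_comm]
    exact L2.inner_indicatorConstLp_one hs hsf.ne z
  obtain ⟨n, hn⟩ := exists_nat_gt ((u - inner ℝ z x₀) / -(∫ ω in s, z ω ∂ν))
  rw [div_lt_iff₀ (by linarith)] at hn
  have h1 := hf _ (hmem n)
  rw [← hzf, inner_sub_right, inner_smul_right, hei] at h1
  linarith

/-- The nonnegative densities in `L²` that give every claim in `D` a nonpositive value. -/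
def polarDensities (ν : Measure Ω) (D : Set (Ω → ℝ)) : Set (Lp ℝ 2 ν) :=
  {z | 0 ≤ z ∧ ∀ x : Lp ℝ 2 ν, (x : Ω → ℝ) ∈ D → inner ℝ z x ≤ 0}

theorem add_mem_polarDensities {z z' : Lp ℝ 2 ν} (hz : z ∈ polarDensities ν D)
    (hz' : z' ∈ polarDensities ν D) : z + z' ∈ polarDensities ν D :=
  ⟨add_nonneg hz.1 hz'.1, fun x hx => by
    rw [inner_add_left]; exact add_nonpos (hz.2 x hx) (hz'.2 x hx)⟩

theorem smul_mem_polarDensities {z : Lp ℝ 2 ν} (hz : z ∈ polarDensities ν D) {c : ℝ}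
    (hc : 0 ≤ c) : c • z ∈ polarDensities ν D := by
  refine ⟨?_, fun x hx => ?_⟩
  · rw [← Lp.coeFn_nonneg]
    filter_upwards [Lp.coeFn_smul c z, (Lp.coeFn_nonneg z).2 hz.1] with ω h1 h2
    rw [h1]
    exact mul_nonneg hc h2
  · rw [real_inner_smul_left]
    exact mul_nonpos_of_nonneg_of_nonpos hc (hz.2 x hx)

/-- Countably many elements of the polar are dominated, up to positive factors, by a single one. -/
theorem exists_mem_polarDensities_ge {z : ℕ → Lp ℝ 2 ν} (hz : ∀ n, z n ∈ polarDensities ν D) :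
    ∃ Z ∈ polarDensities ν D, ∀ n, ∃ c : ℝ, 0 < c ∧ c • z n ≤ Z := by
  set c : ℕ → ℝ := fun n => (1 / 2) ^ n / (1 + ‖z n‖) with hc
  have hc0 : ∀ n, 0 < c n := fun n => by positivity
  have hsum : Summable fun n => c n • z n := by
    refine Summable.of_norm_bounded summable_geometric_two fun n => ?_
    rw [norm_smul, Real.norm_of_nonneg (hc0 n).le]
    simp only [hc]
    rw [div_mul_eq_mul_div, div_le_iff₀ (by positivity)]
    have : (0 : ℝ) < (1 / 2) ^ n := by positivity
    nlinarith [norm_nonneg (z n)]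
  have hmem := fun n => smul_mem_polarDensities (hz n) (hc0 n).le
  refine ⟨∑' n, c n • z n, ⟨tsum_nonneg fun n => (hmem n).1, fun x hx => ?_⟩, fun n =>
    ⟨c n, hc0 n, hsum.le_tsum n fun k _ => (hmem k).1⟩⟩
  rw [real_inner_comm]
  have h := (hsum.hasSum.mapL (innerSL ℝ x))
  refine h.nonpos fun n => ?_
  rw [innerSL_apply_apply, real_inner_comm]
  exact (hmem n).2 x hx

/-- The Kreps–Yan theorem: a closed cone of claims that contains no arbitrage has a strictly
positive density in its polar. A density of maximal support is strictly positive, since otherwise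
the indicator of the complement of its support could be separated from the cone. -/
theorem exists_pos_mem_polarDensities [IsFiniteMeasure ν] (hD : IsClaimCone ⊥ ν D)
    (hcl : AEClosed ν D) (hNA : ∀ X ∈ D, 0 ≤ᵐ[ν] X → X =ᵐ[ν] 0) :
    ∃ z ∈ polarDensities ν D, ∀ᵐ ω ∂ν, 0 < z ω := by
  set m : Lp ℝ 2 ν → ℝ := fun z => ν.real {ω | 0 < z ω} with hm
  have hbdd : BddAbove (m '' polarDensities ν D) := ⟨ν.real Set.univ, by
    rintro _ ⟨z, -, rfl⟩; exact measureReal_mono (Set.subset_univ _)⟩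
  have hne : (m '' polarDensities ν D).Nonempty := ⟨_, 0, ⟨le_rfl, by simp⟩, rfl⟩
  have hex : ∀ n : ℕ, ∃ z ∈ polarDensities ν D,
      sSup (m '' polarDensities ν D) - 1 / ((n : ℝ) + 1) < m z := fun n => by
    obtain ⟨_, ⟨z, hz, rfl⟩, h⟩ := exists_lt_of_lt_csSup hne
      (show sSup (m '' polarDensities ν D) - 1 / ((n : ℝ) + 1) < _ from
        sub_lt_self _ (by positivity))
    exact ⟨z, hz, h⟩
  choose z hz hlt using hex
  obtain ⟨Z, hZ, hdom⟩ := exists_mem_polarDensities_ge hz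
  have hmZ : ∀ n, m (z n) ≤ m Z := fun n => by
    obtain ⟨c, hc, hle⟩ := hdom n
    refine ENNReal.toReal_mono (measure_ne_top _ _) (measure_mono_ae ?_)
    filter_upwards [(Lp.coeFn_le _ _).2 hle, Lp.coeFn_smul c (z n)] with ω h1 h2 h3
    rw [h2] at h1
    exact lt_of_lt_of_le (mul_pos hc h3) h1
  have hmax : ∀ z' ∈ polarDensities ν D, m z' ≤ m Z := fun z' hz' => by
    refine (le_csSup hbdd ⟨z', hz', rfl⟩).trans ?_
    have h1 : Tendsto (fun n : ℕ => sSup (m '' polarDensities ν D) - 1 / ((n : ℝ) + 1)) atTop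
        (𝓝 (sSup (m '' polarDensities ν D) - 0)) :=
      tendsto_const_nhds.sub tendsto_one_div_add_atTop_nhds_zero_nat
    rw [sub_zero] at h1
    exact le_of_tendsto h1 (Eventually.of_forall fun n => (hlt n).le.trans (hmZ n))
  refine ⟨Z, hZ, ?_⟩
  have hZm : MeasurableSet {ω | 0 < Z ω} :=
    measurableSet_lt measurable_const (Lp.stronglyMeasurable Z).measurable
  set A : Set Ω := {ω | 0 < Z ω}ᶜ with hA
  have hAm : MeasurableSet A := hZm.compl
  by_contra hnot
  have hνA : ν A ≠ 0 := fun h => hnot (by rw [ae_iff]; exact h)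
  set e : Lp ℝ 2 ν := indicatorConstLp 2 hAm (measure_ne_top _ _) 1 with he
  have hecoe : ∀ᵐ ω ∂ν, e ω = A.indicator (fun _ => 1) ω := indicatorConstLp_coeFn
  have heD : (e : Ω → ℝ) ∉ D := fun h => by
    have h0 := hNA _ h (by
      filter_upwards [hecoe] with ω hω
      rw [hω]; exact Set.indicator_nonneg (fun _ _ => zero_le_one) ω)
    refine hνA (measure_mono_null (fun ω hω => ?_) (ae_iff.1 (h0.and hecoe)))
    rintro ⟨h1, h2⟩
    rw [h1, Set.indicator_of_mem hω] at h2
    exact zero_ne_one h2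
  have h0D : ((0 : Lp ℝ 2 ν) : Ω → ℝ) ∈ D :=
    hD.mono hD.zero_mem (Lp.coeFn_zero ℝ 2 ν).le
  obtain ⟨z', hz'0, u, hu, hue⟩ := exists_nonneg_separating hD.convex hcl hD.mono h0D heD
  have hu0 : 0 < u := by simpa using hu 0 h0D
  have hz' : z' ∈ polarDensities ν D := by
    refine ⟨hz'0, fun x hx => ?_⟩
    by_contra! hpos
    obtain ⟨n, hn⟩ := exists_nat_gt (u / inner ℝ z' x)
    rw [div_lt_iff₀ hpos] at hn
    have := hu ((n : ℝ) • x) (hD.mono (hD.smul_mem n.cast_nonneg hx) (Lp.coeFn_smul _ x).le)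
    rw [real_inner_smul_right] at this
    linarith
  have hpos : 0 < inner ℝ z' e := hu0.trans hue
  have hzm' : MeasurableSet {ω | 0 < z' ω} :=
    measurableSet_lt measurable_const (Lp.stronglyMeasurable z').measurable
  -- `z'` charges the complement of the support of `Z`, so `Z + z'` has a larger support
  have hB : ν (A ∩ {ω | 0 < z' ω}) ≠ 0 := fun h => by
    rw [real_inner_comm, L2.inner_indicatorConstLp_one] at hpos
    refine hpos.ne' (setIntegral_eq_zero_of_ae_eq_zero ?_)
    have h1 : ∀ᵐ ω ∂ν, ω ∉ A ∩ {ω | 0 < z' ω} := measure_eq_zero_iff_ae_notMem.1 h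
    filter_upwards [h1, (Lp.coeFn_nonneg _).2 hz'0] with ω h2 h3 h4
    exact le_antisymm (not_lt.1 fun h5 => h2 ⟨h4, h5⟩) h3
  have hlt' : m Z < m (Z + z') := by
    have h1 : m Z + ν.real (A ∩ {ω | 0 < z' ω}) ≤ m (Z + z') := by
      rw [hm, ← measureReal_union (Set.disjoint_left.2 fun ω h1 h2 => h2.1 h1) (hAm.inter hzm')]
      refine ENNReal.toReal_mono (measure_ne_top _ _) (measure_mono_ae ?_)
      filter_upwards [Lp.coeFn_add Z z', (Lp.coeFn_nonneg _).2 hz'0, (Lp.coeFn_nonneg _).2 hZ.1]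
        with ω h1 h2 h3 h4
      change 0 < (Z + z') ω
      rw [h1, Pi.add_apply]
      simp only [Pi.zero_apply] at h2 h3
      rcases h4 with h4 | h4
      · have : 0 < Z ω := h4
        linarith
      · have : 0 < z' ω := h4.2
        linarith
    have h2 : 0 < ν.real (A ∩ {ω | 0 < z' ω}) :=
      ENNReal.toReal_pos hB (measure_ne_top _ _)
    linarith
  exact absurd (hmax _ (add_mem_polarDensities hZ hz')) (not_le.2 hlt')

/-- Finitely many random variables are square integrable under some equivalent finite measure. -/
theorem exists_equivalent_memLp_two [IsFiniteMeasure P] {κ : Type*} [Fintype κ] {F : κ → Ω → ℝ}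
    (hF : ∀ k, Measurable (F k)) :
    ∃ ν : Measure Ω, IsFiniteMeasure ν ∧ ν ≪ P ∧ P ≪ ν ∧ ∀ k, MemLp (F k) 2 ν := by
  set w : Ω → ℝ := fun ω => 1 / (1 + ∑ k, F k ω ^ 2) with hw
  have hpos : ∀ ω, 0 < 1 + ∑ k, F k ω ^ 2 := fun ω => by positivity
  have hwm : Measurable w := measurable_const.div
    (measurable_const.add (Finset.measurable_fun_sum _ fun k _ => (hF k).pow_const 2))
  have hw0 : ∀ ω, 0 < w ω := fun ω => one_div_pos.2 (hpos ω)
  have hw1 : ∀ ω, w ω ≤ 1 := fun ω => by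
    rw [hw, div_le_one (hpos ω)]
    linarith [Finset.sum_nonneg fun k (_ : k ∈ Finset.univ) => sq_nonneg (F k ω)]
  have hwi : Integrable w P := Integrable.of_bound hwm.aestronglyMeasurable 1
    (ae_of_all _ fun ω => by rw [Real.norm_of_nonneg (hw0 ω).le]; exact hw1 ω)
  have hfin : IsFiniteMeasure (P.withDensity fun ω => ENNReal.ofReal (w ω)) :=
    isFiniteMeasure_withDensity_ofReal hwi.2
  refine ⟨_, hfin, withDensity_absolutelyContinuous _ _,
    withDensity_absolutelyContinuous' hwm.ennreal_ofReal.aemeasurable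
      (ae_of_all _ fun ω => (ENNReal.ofReal_pos.2 (hw0 ω)).ne'), fun k => ?_⟩
  rw [memLp_two_iff_integrable_sq (hF k).aestronglyMeasurable,
    integrable_withDensity_iff hwm.ennreal_ofReal (ae_of_all _ fun _ => ENNReal.ofReal_lt_top)]
  refine Integrable.of_bound (((hF k).pow_const 2).mul
    hwm.ennreal_ofReal.ennreal_toReal).aestronglyMeasurable 1 (ae_of_all _ fun ω => ?_)
  rw [ENNReal.toReal_ofReal (hw0 ω).le, Real.norm_of_nonneg (by have := hw0 ω; positivity), hw,
    mul_one_div, div_le_one (hpos ω)]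
  have := Finset.single_le_sum (fun k _ => sq_nonneg (F k ω)) (Finset.mem_univ k)
  linarith

/-- Normalizing a strictly positive density in `L²` gives an equivalent probability measure. -/
theorem exists_probabilityMeasure_of_density [IsFiniteMeasure ν] (hν : ν ≠ 0) {z : Lp ℝ 2 ν}
    (hz : ∀ᵐ ω ∂ν, 0 < z ω) :
    ∃ Q : Measure Ω, IsProbabilityMeasure Q ∧ Q ≪ ν ∧ ν ≪ Q ∧ ∀ X : Ω → ℝ, MemLp X 2 ν →
      Integrable X Q ∧ ∫ ω, X ω ∂Q = (∫ ω, z ω ∂ν)⁻¹ * ∫ ω, z ω * X ω ∂ν := by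
  have hzi : Integrable z ν := (Lp.memLp z).integrable one_le_two
  have hzm : Measurable z := (Lp.stronglyMeasurable z).measurable
  have hI : 0 < ∫ ω, z ω ∂ν := by
    rw [integral_pos_iff_support_of_nonneg_ae (hz.mono fun _ h => h.le) hzi]
    refine pos_iff_ne_zero.2 fun h => hν ?_
    have h1 : ∀ᵐ ω ∂ν, z ω = 0 := by
      have := measure_eq_zero_iff_ae_notMem.1 h
      filter_upwards [this] with ω hω
      simpa using hω
    have h2 : ∀ᵐ ω ∂ν, False := by
      filter_upwards [h1, hz] with ω h3 h4
      exact h4.ne' h3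
    exact ae_eq_bot.1 (eventually_false_iff_eq_bot.1 h2)
  set c : ℝ := (∫ ω, z ω ∂ν)⁻¹ with hc
  have hc0 : 0 < c := inv_pos.2 hI
  set ρ : Ω → ENNReal := fun ω => ENNReal.ofReal (c * z ω) with hρ
  have hρm : Measurable ρ := (hzm.const_mul c).ennreal_ofReal
  have hlt : ∀ᵐ ω ∂ν, ρ ω < ⊤ := ae_of_all _ fun _ => ENNReal.ofReal_lt_top
  have hreal : ∀ᵐ ω ∂ν, (ρ ω).toReal = c * z ω := by
    filter_upwards [hz] with ω h
    exact ENNReal.toReal_ofReal (mul_pos hc0 h).le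
  have hint : ∀ X : Ω → ℝ, ∫ ω, X ω ∂(ν.withDensity ρ) = c * ∫ ω, z ω * X ω ∂ν := fun X => by
    rw [integral_withDensity_eq_integral_toReal_smul hρm hlt, ← integral_const_mul]
    refine integral_congr_ae ?_
    filter_upwards [hreal] with ω h
    rw [h, smul_eq_mul, mul_assoc]
  refine ⟨ν.withDensity ρ, ⟨?_⟩, withDensity_absolutelyContinuous _ _,
    withDensity_absolutelyContinuous' hρm.aemeasurable ?_, fun X hX => ⟨?_, hint X⟩⟩
  · rw [withDensity_apply _ MeasurableSet.univ, Measure.restrict_univ,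
      ← ofReal_integral_eq_lintegral_ofReal (hzi.const_mul c), integral_const_mul, hc,
      inv_mul_cancel₀ hI.ne', ENNReal.ofReal_one]
    filter_upwards [hz] with ω h
    exact (mul_pos hc0 h).le
  · filter_upwards [hz] with ω h
    exact (ENNReal.ofReal_pos.2 (mul_pos hc0 h)).ne'
  · rw [integrable_withDensity_iff_integrable_smul' hρm hlt]
    have h1 : Integrable (fun ω => c * (z ω * X ω)) ν :=
      ((Lp.memLp z).integrable_mul hX).const_mul c
    refine h1.congr ?_
    filter_upwards [hreal] with ω h
    rw [h, smul_eq_mul, mul_assoc]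

end SemiStatic

/-! ### Stochastic integrals, randomized stopping and martingales under a fixed measure -/

namespace SemiStatic

variable {Ω : Type*} [mΩ : MeasurableSpace Ω] {P Q : Measure Ω}

theorem integral_mul_eq_zero_of_setIntegral [IsProbabilityMeasure Q] {G : MeasurableSpace Ω}
    (hG : G ≤ mΩ) {ξ : Ω → ℝ} (hξ : Integrable ξ Q)
    (h0 : ∀ A, MeasurableSet[G] A → ∫ ω in A, ξ ω ∂Q = 0) {H : Ω → ℝ} (hH : Measurable[G] H)
    {C : ℝ} (hb : ∀ ω, |H ω| ≤ C) :
    Integrable (H * ξ) Q ∧ ∫ ω, (H * ξ) ω ∂Q = 0 := by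
  have hce : Q[ξ | G] =ᵐ[Q] fun _ => (0 : ℝ) :=
    (ae_eq_condExp_of_forall_setIntegral_eq hG hξ (fun _ _ _ => integrableOn_zero)
      (fun A hA _ => by rw [h0 A hA, integral_zero]) aestronglyMeasurable_zero).symm
  have hint : Integrable (H * ξ) Q :=
    hξ.bdd_mul (hH.mono hG le_rfl).aestronglyMeasurable (ae_of_all _ hb)
  refine ⟨hint, ?_⟩
  have hpull := condExp_mul_of_stronglyMeasurable_left (m := G) hH.stronglyMeasurable hint hξ
  rw [← integral_condExp hG]
  refine integral_eq_zero_of_ae ?_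
  filter_upwards [hpull, hce] with ω h1 h2
  rw [h1, Pi.mul_apply, h2, mul_zero]
  rfl

/-- Trading assets whose increments have zero conditional mean does not produce a positive
expectation as long as the outcome is bounded below by an integrable claim, although the volumes
are unbounded. The asset with the least information is split off by truncating its volume. -/
theorem integral_trading_nonpos [IsProbabilityMeasure Q] {ι : Type*} {G : ι → MeasurableSpace Ω}
    {ξ : ι → Ω → ℝ} (rk : ι → ℕ) (hrk : ∀ i j, rk i ≤ rk j → G i ≤ G j) (hG : ∀ i, G i ≤ mΩ)
    (hξ : ∀ i, Integrable (ξ i) Q)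
    (h0 : ∀ i A, MeasurableSet[G i] A → ∫ ω in A, ξ i ω ∂Q = 0) (s : Finset ι) :
    ∀ (H : ι → Ω → ℝ) (Z : Ω → ℝ), (∀ i, Measurable[G i] (H i)) → Integrable Z Q →
      (∀ᵐ ω ∂Q, Z ω ≤ ∑ i ∈ s, H i ω * ξ i ω) →
      Integrable (fun ω => ∑ i ∈ s, H i ω * ξ i ω) Q ∧
        ∫ ω, ∑ i ∈ s, H i ω * ξ i ω ∂Q ≤ 0 := by
  classical
  induction s using Finset.induction_on_min_value rk with
  | empty => intros; simp
  | insert i s hi hmin ih =>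
    intro H Z hH hZ hle
    set V : Ω → ℝ := fun ω => ∑ j ∈ insert i s, H j ω * ξ j ω with hV
    have hVeq : ∀ ω, V ω = H i ω * ξ i ω + ∑ j ∈ s, H j ω * ξ j ω := fun ω =>
      Finset.sum_insert hi
    have hVm : AEStronglyMeasurable V Q := by
      refine Finset.aestronglyMeasurable_fun_sum _ fun j _ => ?_
      exact ((hH j).mono (hG j) le_rfl).aestronglyMeasurable.mul (hξ j).aestronglyMeasurable
    set A : ℕ → Set Ω := fun n => {ω | |H i ω| ≤ n} with hA
    have hAm : ∀ n, MeasurableSet[G i] (A n) := fun n =>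
      measurableSet_le (continuous_abs.measurable.comp (hH i)) measurable_const
    have hAmono : Monotone A := by
      intro m n hmn ω hω
      exact le_trans (show |H i ω| ≤ m from hω) (Nat.cast_le.2 hmn)
    have hAU : ⋃ n, A n = Set.univ := Set.eq_univ_of_forall fun ω =>
      Set.mem_iUnion.2 (exists_nat_ge |H i ω|)
    have hone : ∀ n, Measurable[G i] ((A n).indicator fun _ => (1 : ℝ)) := fun n =>
      measurable_const.indicator (hAm n)
    have hprop : ∀ n, Integrable ((A n).indicator V) Q ∧ ∫ ω, (A n).indicator V ω ∂Q ≤ 0 := by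
      intro n
      have h1 := integral_mul_eq_zero_of_setIntegral (hG i) (hξ i) (h0 i)
        (H := (A n).indicator (H i)) ((hH i).indicator (hAm n)) (C := n) (fun ω => by
          by_cases hω : ω ∈ A n
          · rw [Set.indicator_of_mem hω]; exact hω
          · rw [Set.indicator_of_notMem hω]; simp)
      have h2 := ih (fun j ω => if j ∈ s then (A n).indicator (fun _ => (1 : ℝ)) ω * H j ω else 0)
        (fun ω => (A n).indicator Z ω - ((A n).indicator (H i) * ξ i) ω) (fun j => ?_)
        ((hZ.indicator (hG i _ (hAm n))).sub h1.1) ?_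
      · have h3 : (A n).indicator V = fun ω => ((A n).indicator (H i) * ξ i) ω +
            ∑ j ∈ s, (if j ∈ s then (A n).indicator (fun _ => (1 : ℝ)) ω * H j ω else 0)
              * ξ j ω := by
          ext ω
          by_cases hω : ω ∈ A n
          · simp only [Pi.mul_apply, Set.indicator_of_mem hω, hVeq, one_mul]
            congr 1
            exact Finset.sum_congr rfl fun j hj => by rw [if_pos hj]
          · simp [Set.indicator_of_notMem hω]
        rw [h3]
        refine ⟨h1.1.add h2.1, ?_⟩
        rw [integral_add h1.1 h2.1, h1.2, zero_add]
        exact h2.2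
      · by_cases hj : j ∈ s
        · simp only [hj, if_true]
          exact ((hone n).mono (hrk i j (hmin j hj)) le_rfl).mul (hH j)
        · simp only [hj, if_false]
          exact measurable_const
      · filter_upwards [hle] with ω hω
        by_cases hωA : ω ∈ A n
        · change Z ω ≤ V ω at hω
          rw [hVeq] at hω
          have h4 : ∑ j ∈ s, (if j ∈ s then (A n).indicator (fun _ => (1 : ℝ)) ω * H j ω else 0)
              * ξ j ω = ∑ j ∈ s, H j ω * ξ j ω :=
            Finset.sum_congr rfl fun j hj => by
              rw [if_pos hj, Set.indicator_of_mem hωA, one_mul]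
          rw [h4]
          simp only [Pi.mul_apply, Set.indicator_of_mem hωA]
          linarith
        · simp [Set.indicator_of_notMem hωA]
    -- Fatou's lemma, applied to the truncations, gives integrability
    have hVZ : Integrable (fun ω => V ω + |Z ω|) Q := by
      have hnn : ∀ᵐ ω ∂Q, 0 ≤ V ω + |Z ω| := by
        filter_upwards [hle] with ω hω
        have h5 : Z ω ≤ V ω := hω
        linarith [neg_abs_le (Z ω)]
      refine (lintegral_ofReal_ne_top_iff_integrable (hVm.add hZ.abs.aestronglyMeasurable) hnn).1 ?_
      have hbound : ∀ n, ∫⁻ ω, ENNReal.ofReal ((A n).indicator V ω + |Z ω|) ∂Q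
          ≤ ENNReal.ofReal (∫ ω, |Z ω| ∂Q) := fun n => by
        have hadd : Integrable (fun ω => (A n).indicator V ω + |Z ω|) Q := (hprop n).1.add hZ.abs
        rw [← ofReal_integral_eq_lintegral_ofReal hadd ?_]
        · refine ENNReal.ofReal_le_ofReal ?_
          rw [integral_add (hprop n).1 hZ.abs]
          linarith [(hprop n).2]
        · filter_upwards [hnn] with ω hω
          by_cases hωA : ω ∈ A n
          · simpa [Set.indicator_of_mem hωA] using hω
          · simp [Set.indicator_of_notMem hωA]
      have hlim : ∀ ω, Tendsto (fun n => ENNReal.ofReal ((A n).indicator V ω + |Z ω|)) atTop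
          (𝓝 (ENNReal.ofReal (V ω + |Z ω|))) := fun ω => by
        refine tendsto_const_nhds.congr' ?_
        obtain ⟨n₀, hn₀⟩ := exists_nat_ge |H i ω|
        filter_upwards [eventually_ge_atTop n₀] with n hn
        rw [Set.indicator_of_mem (show ω ∈ A n from hAmono hn hn₀)]
      have hfatou := lintegral_liminf_le' (μ := Q) (u := (atTop : Filter ℕ))
        (f := fun n ω => ENNReal.ofReal ((A n).indicator V ω + |Z ω|)) fun n =>
          ((hprop n).1.add hZ.abs).aestronglyMeasurable.aemeasurable.ennreal_ofReal
      simp only [(hlim _).liminf_eq] at hfatou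
      refine ne_top_of_le_ne_top (ENNReal.ofReal_ne_top (r := ∫ ω, |Z ω| ∂Q)) (hfatou.trans ?_)
      exact liminf_le_of_le (by isBoundedDefault) fun b hb => by
        obtain ⟨n, hn⟩ := hb.exists
        exact hn.trans (hbound n)
    have hVi : Integrable V Q := (hVZ.sub hZ.abs).congr (ae_of_all _ fun ω => by simp)
    refine ⟨hVi, ?_⟩
    have hlim := tendsto_setIntegral_of_monotone (fun n => hG i _ (hAm n)) hAmono
      (hVi.integrableOn (s := ⋃ n, A n))
    rw [hAU, setIntegral_univ] at hlim
    refine le_of_tendsto hlim (Eventually.of_forall fun n => ?_)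
    rw [← integral_indicator (hG i _ (hAm n))]
    exact (hprop n).2

section Randomization

variable {T : ℕ} {ℱ : Filtration (Fin (T + 1)) mΩ} {η φ : Fin (T + 1) → Ω → ℝ}

/-- The first date at which the liquidated fraction reaches the level `u`, and the last date if it
does not. -/
noncomputable def levelTime (η : Fin (T + 1) → Ω → ℝ) (u : ℝ) (ω : Ω) : Fin (T + 1) :=
  open Classical in
  (Finset.univ.filter fun t => u ≤ ∑ r ∈ Finset.Iic t, η r ω ∨ t = Fin.last T).min'
    ⟨Fin.last T, by simp⟩

omit mΩ in
theorem levelTime_le_iff (h0 : ∀ t ω, 0 ≤ η t ω) (u : ℝ) (ω : Ω) (t : Fin (T + 1)) :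
    levelTime η u ω ≤ t ↔ u ≤ ∑ r ∈ Finset.Iic t, η r ω ∨ t = Fin.last T := by
  classical
  constructor
  · intro h
    have hmem := Finset.min'_mem (Finset.univ.filter fun t =>
      u ≤ ∑ r ∈ Finset.Iic t, η r ω ∨ t = Fin.last T) ⟨Fin.last T, by simp⟩
    rcases (Finset.mem_filter.1 hmem).2 with h1 | h1
    · exact Or.inl (h1.trans (Finset.sum_le_sum_of_subset_of_nonneg
        (Finset.Iic_subset_Iic.2 h) fun r _ _ => h0 r ω))
    · exact Or.inr (le_antisymm (Fin.le_last t) (h1 ▸ h))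
  · intro h
    exact Finset.min'_le _ _ (by simpa using h)

theorem levelTime_mem_stoppingTimes (hη : Adapted ℱ η) (h0 : ∀ t ω, 0 ≤ η t ω) (u : ℝ) :
    levelTime η u ∈ stoppingTimes ℱ := by
  intro t
  have hset : {ω | (levelTime η u ω : WithTop (Fin (T + 1))) ≤ t}
      = {ω | u ≤ ∑ r ∈ Finset.Iic t, η r ω ∨ t = Fin.last T} := by
    ext ω
    simp only [Set.mem_ofPred_eq, WithTop.coe_le_coe, levelTime_le_iff h0]
  rw [hset]
  refine MeasurableSet.union ?_ (MeasurableSet.const _)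
  have hsum : Measurable[ℱ t] fun ω => ∑ r ∈ Finset.Iic t, η r ω :=
    Finset.measurable_fun_sum _ fun r hr =>
      (hη r).mono (ℱ.mono (Finset.mem_Iic.1 hr)) le_rfl
  exact measurableSet_le measurable_const hsum

omit mΩ in
theorem levelTime_eq_iff (h0 : ∀ t ω, 0 ≤ η t ω) {u : ℝ} (hu : u ∈ Set.Ioc (0 : ℝ) 1) {ω : Ω}
    (h1 : ∑ t, η t ω = 1) (t : Fin (T + 1)) :
    levelTime η u ω = t ↔
      u ∈ Set.Ioc (∑ r ∈ Finset.Iio t, η r ω) (∑ r ∈ Finset.Iic t, η r ω) := by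
  have hle : ∀ t, levelTime η u ω ≤ t ↔ u ≤ ∑ r ∈ Finset.Iic t, η r ω := fun t => by
    rw [levelTime_le_iff h0]
    refine ⟨?_, Or.inl⟩
    rintro (h | rfl)
    · exact h
    · have : Finset.Iic (Fin.last T) = Finset.univ := by ext; simp [Fin.le_last]
      rw [this, h1]
      exact hu.2
  have hlt : levelTime η u ω < t ↔ u ≤ ∑ r ∈ Finset.Iio t, η r ω := by
    refine Fin.cases ?_ (fun s => ?_) t
    · have : Finset.Iio (0 : Fin (T + 1)) = ∅ := by ext; simp
      simp [this, hu.1]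
    · have : Finset.Iio s.succ = Finset.Iic s.castSucc := by
        ext r; simp [Fin.lt_def, Fin.le_def]
      rw [this, ← hle]
      simp [Fin.lt_def, Fin.le_def]
  rw [Set.mem_Ioc, ← hle, ← not_le (a := u), ← hlt, not_lt]
  exact ⟨fun h => ⟨h.ge, h.le⟩, fun h => le_antisymm h.2 h.1⟩

/-- Randomized liquidation is no better than optimal stopping: the expected payoff of a
liquidating strategy is the average over the levels `u ∈ (0, 1]` of the expected payoffs from
stopping once the fraction `u` has been liquidated. -/
theorem integral_liquidate_le [IsProbabilityMeasure Q] (hη : Adapted ℱ η)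
    (h0 : ∀ t ω, 0 ≤ η t ω) (h1 : ∀ᵐ ω ∂Q, ∑ t, η t ω = 1) (hφ : Adapted ℱ φ) {K : ℝ}
    (hK : ∀ t ω, |φ t ω| ≤ K) {s : ℝ}
    (hs : ∀ τ ∈ stoppingTimes ℱ, ∫ ω, φ (τ ω) ω ∂Q ≤ s) :
    ∫ ω, liquidate η φ ω ∂Q ≤ s := by
  classical
  have hηm : ∀ t, Measurable (η t) := fun t => (hη t).mono (ℱ.le t) le_rfl
  have hφm : ∀ t, Measurable (φ t) := fun t => (hφ t).mono (ℱ.le t) le_rfl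
  set lo : Fin (T + 1) → Ω → ℝ := fun t ω => ∑ r ∈ Finset.Iio t, η r ω with hlo
  set hi : Fin (T + 1) → Ω → ℝ := fun t ω => ∑ r ∈ Finset.Iic t, η r ω with hhi
  have hlom : ∀ t, Measurable (lo t) := fun t => Finset.measurable_fun_sum _ fun r _ => hηm r
  have hhim : ∀ t, Measurable (hi t) := fun t => Finset.measurable_fun_sum _ fun r _ => hηm r
  have hdiff : ∀ t ω, hi t ω - lo t ω = η t ω := fun t ω => by
    simp only [hlo, hhi]
    rw [← Finset.Iio_insert, Finset.sum_insert (by simp)]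
    ring
  set κ : Measure ℝ := volume.restrict (Set.Ioc 0 1) with hl1
  have : IsProbabilityMeasure κ := ⟨by simp [hl1]⟩
  set E : Fin (T + 1) → Set (ℝ × Ω) := fun t => {p | lo t p.2 < p.1 ∧ p.1 ≤ hi t p.2} with hE
  have hEm : ∀ t, MeasurableSet (E t) := fun t =>
    (measurableSet_lt ((hlom t).comp measurable_snd) measurable_fst).inter
      (measurableSet_le measurable_fst ((hhim t).comp measurable_snd))
  set Ψ : ℝ → Ω → ℝ := fun u ω => ∑ t, (E t).indicator (fun p => φ t p.2) (u, ω) with hΨ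
  have hΨi : Integrable (Function.uncurry Ψ) (κ.prod Q) := by
    refine integrable_finsetSum _ fun t _ => Integrable.indicator ?_ (hEm t)
    exact Integrable.of_bound ((hφm t).comp measurable_snd).aestronglyMeasurable K
      (ae_of_all _ fun p => hK t p.2)
  have hleft : ∀ᵐ u ∂κ, ∫ ω, Ψ u ω ∂Q ≤ s := by
    filter_upwards [ae_restrict_mem measurableSet_Ioc] with u hu
    refine le_trans (le_of_eq (integral_congr_ae ?_))
      (hs _ (levelTime_mem_stoppingTimes hη h0 u))
    filter_upwards [h1] with ω hω
    have : ∀ t, (E t).indicator (fun p => φ t p.2) (u, ω)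
        = if levelTime η u ω = t then φ t ω else 0 := fun t => by
      rw [Set.indicator_apply]
      exact if_congr (levelTime_eq_iff h0 hu hω t).symm rfl rfl
    simp only [hΨ, this]
    simp
  have hright : ∀ᵐ ω ∂Q, ∫ u, Ψ u ω ∂κ = liquidate η φ ω := by
    filter_upwards [h1] with ω hω
    have hset : ∀ t u, (E t).indicator (fun p => φ t p.2) (u, ω)
        = (Set.Ioc (lo t ω) (hi t ω)).indicator (fun _ => φ t ω) u := fun t u => by
      simp only [Set.indicator_apply]
      rfl
    simp only [hΨ, hset]
    rw [integral_finsetSum _ fun t _ => (integrable_const _).indicator measurableSet_Ioc]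
    refine Finset.sum_congr rfl fun t _ => ?_
    have hlo0 : 0 ≤ lo t ω := Finset.sum_nonneg fun r _ => h0 r ω
    have hhi1 : hi t ω ≤ 1 := hω ▸ Finset.sum_le_sum_of_subset_of_nonneg
      (Finset.subset_univ _) fun r _ _ => h0 r ω
    have hsub : Set.Ioc (lo t ω) (hi t ω) ⊆ Set.Ioc 0 1 := Set.Ioc_subset_Ioc hlo0 hhi1
    rw [integral_indicator_const _ measurableSet_Ioc, hl1, measureReal_restrict_apply
      measurableSet_Ioc, Set.inter_eq_left.2 hsub, Real.volume_real_Ioc, hdiff,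
      max_eq_left (h0 t ω), smul_eq_mul, mul_comm]
  calc ∫ ω, liquidate η φ ω ∂Q = ∫ ω, ∫ u, Ψ u ω ∂κ ∂Q := (integral_congr_ae hright).symm
    _ = ∫ u, ∫ ω, Ψ u ω ∂Q ∂κ := (integral_integral_swap hΨi).symm
    _ ≤ ∫ _, s ∂κ := integral_mono_ae hΨi.integral_prod_left (integrable_const s) hleft
    _ = s := by simp

end Randomization

section Martingale

variable {T d : ℕ} {ℱ : Filtration (Fin (T + 1)) mΩ} {S : Fin (T + 1) → Ω → (Fin d → ℝ)}

theorem setIntegral_increment_eq_zero [IsProbabilityMeasure Q] (hS : Martingale S ℱ Q)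
    (t : Fin T) (i : Fin d) {A : Set Ω} (hA : MeasurableSet[ℱ t.castSucc] A) :
    ∫ ω in A, (S t.succ ω i - S t.castSucc ω i) ∂Q = 0 := by
  have hint : ∀ t i, Integrable (fun ω => S t ω i) Q := fun t i => (hS.integrable t).eval i
  have h := congrFun (hS.setIntegral_eq t.castSucc_lt_succ.le hA) i
  rw [eval_integral fun i => (hint _ i).integrableOn,
    eval_integral fun i => (hint _ i).integrableOn] at h
  rw [integral_sub (hint _ i).integrableOn (hint _ i).integrableOn, h, sub_self]

theorem martingale_of_setIntegral_increment_eq_zero [IsProbabilityMeasure Q] (hS : Adapted ℱ S)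
    (hint : ∀ t i, Integrable (fun ω => S t ω i) Q)
    (h0 : ∀ (t : Fin T) (i : Fin d) (A : Set Ω), MeasurableSet[ℱ t.castSucc] A →
      ∫ ω in A, (S t.succ ω i - S t.castSucc ω i) ∂Q = 0) : Martingale S ℱ Q := by
  have hintS : ∀ t, Integrable (S t) Q := fun t => Integrable.of_eval (hint t)
  refine ⟨fun t => (hS t).stronglyMeasurable, fun s t hst => ?_⟩
  have hset : ∀ A, MeasurableSet[ℱ s] A → ∀ i, ∀ t, s ≤ t →
      ∫ ω in A, S s ω i ∂Q = ∫ ω in A, S t ω i ∂Q := by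
    intro A hA i t
    refine Fin.induction ?_ (fun u ih => ?_) t
    · intro h
      rw [le_antisymm h (Fin.zero_le s)]
    · intro h
      rcases h.eq_or_lt with rfl | h
      · rfl
      · have hu : s ≤ u.castSucc := Fin.le_castSucc_iff.2 h
        have h1 := h0 u i A (ℱ.mono hu A hA)
        rw [integral_sub (hint _ i).integrableOn (hint _ i).integrableOn] at h1
        rw [ih hu]
        linarith
  refine (ae_eq_condExp_of_forall_setIntegral_eq (ℱ.le s) (hintS t)
    (fun _ _ _ => (hintS s).integrableOn) (fun A hA _ => ?_)
    (hS s).stronglyMeasurable.aestronglyMeasurable).symm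
  ext i
  rw [eval_integral fun i => (hint _ i).integrableOn,
    eval_integral fun i => (hint _ i).integrableOn]
  exact hset A hA i t hst

end Martingale

end SemiStatic

/-! ### Pricing measures and superreplicable claims -/

namespace SemiStatic

variable {Ω : Type*} [mΩ : MeasurableSpace Ω] {P Q : Measure Ω} {T d L M N : ℕ}

theorem measurable_liquidate {ℱ : Filtration (Fin (T + 1)) mΩ} {η φ : Fin (T + 1) → Ω → ℝ}
    (hη : Adapted ℱ η) (hφ : Adapted ℱ φ) : Measurable (liquidate η φ) :=
  Finset.measurable_fun_sum _ fun t _ =>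
    ((hφ t).mono (ℱ.le t) le_rfl).mul ((hη t).mono (ℱ.le t) le_rfl)

theorem integral_le_of_optimalStoppingValue_le {ℱ : Filtration (Fin (T + 1)) mΩ}
    {φ : Fin (T + 1) → Ω → ℝ} {s : ℝ} (h : optimalStoppingValue ℱ Q φ ≤ s)
    {τ : Ω → Fin (T + 1)} (hτ : τ ∈ stoppingTimes ℱ) : ∫ ω, φ (τ ω) ω ∂Q ≤ s :=
  EReal.coe_le_coe_iff.1 ((le_iSup₂ (f := fun (τ : Ω → Fin (T + 1)) (_ : τ ∈ stoppingTimes ℱ) =>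
    ((∫ ω, φ (τ ω) ω ∂Q : ℝ) : EReal)) τ hτ).trans h)

theorem integral_liquidate_le_optimalStoppingValue [IsProbabilityMeasure Q] (hQP : Q ≪ P)
    {ℱ : Filtration (Fin (T + 1)) mΩ} {η φ : Fin (T + 1) → Ω → ℝ} (hη : IsLiquidating ℱ P η)
    (hφ : Adapted ℱ φ) {K : ℝ} (hK : ∀ t ω, |φ t ω| ≤ K) :
    ((∫ ω, liquidate η φ ω ∂Q : ℝ) : EReal) ≤ optimalStoppingValue ℱ Q φ := by
  refine EReal.le_of_forall_lt_iff_le.1 fun s hs => ?_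
  exact EReal.coe_le_coe_iff.2 (integral_liquidate_le hη.adapted hη.nonneg
    (hQP.ae_le hη.sum_eq_one) hφ hK fun τ hτ =>
      integral_le_of_optimalStoppingValue_le hs.le hτ)

namespace Market

variable {mkt : Market Ω T d L M N} {pg : Fin M → ℝ} {ph : Fin N → ℝ}

theorem assetInfo_le (i : Fin L ⊕ (Fin T × Fin d)) : mkt.assetInfo i ≤ mΩ := by
  rcases i with i | ⟨t, i⟩
  exacts [bot_le, mkt.ℱ.le _]

theorem measurable_of_mem_optionPayoffs {i : Fin M ⊕ Fin N} {w : Ω → ℝ}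
    (hw : w ∈ mkt.optionPayoffs P pg ph i) : Measurable w := by
  rcases i with j | k
  · rw [show w = _ from hw]
    exact ((mkt.measurable_g j).mono (mkt.ℱ.le _) le_rfl).sub_const _
  · obtain ⟨η, hη, rfl⟩ := hw
    exact (measurable_liquidate hη.adapted (mkt.adapted_h k)).sub_const _

theorem memLp_of_mem_optionPayoffs [IsFiniteMeasure Q] (hQP : Q ≪ P) {p : ENNReal}
    {i : Fin M ⊕ Fin N} {w : Ω → ℝ} (hw : w ∈ mkt.optionPayoffs P pg ph i) : MemLp w p Q := by
  obtain ⟨K, hK⟩ := exists_bound_optionPayoffs mkt P pg ph i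
  exact MemLp.of_bound (measurable_of_mem_optionPayoffs hw).aestronglyMeasurable K
    (hQP.ae_le (hK w hw))

theorem IsPricingMeasure.integral_optionPayoffs_nonpos (hQ : mkt.IsPricingMeasure P Q)
    {i : Fin M ⊕ Fin N} {w : Ω → ℝ} (hw : w ∈ mkt.optionPayoffs P mkt.gbar mkt.hbar i) :
    ∫ ω, w ω ∂Q ≤ 0 := by
  have := hQ.prob
  rcases i with j | k
  · obtain ⟨K, hK⟩ := mkt.bounded_g
    have hint : Integrable (mkt.g j) Q := Integrable.of_bound
      ((mkt.measurable_g j).mono (mkt.ℱ.le _) le_rfl).aestronglyMeasurable K (ae_of_all _ (hK j))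
    rw [show w = _ from hw, integral_sub hint (integrable_const _)]
    have := hQ.price_g j
    simp only [integral_const, probReal_univ, one_smul]
    linarith
  · obtain ⟨η, hη, rfl⟩ := hw
    obtain ⟨K, hK⟩ := mkt.bounded_h
    have hint : Integrable (liquidate η (mkt.h k)) Q := Integrable.of_bound
      (measurable_liquidate hη.adapted (mkt.adapted_h k)).aestronglyMeasurable K
      (hQ.ac.ae_le (hη.abs_liquidate_le (hK k)))
    have h1 := (integral_liquidate_le_optimalStoppingValue hQ.ac hη (mkt.adapted_h k)
      (hK k)).trans (hQ.price_h k).le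
    rw [EReal.coe_le_coe_iff] at h1
    rw [integral_sub hint (integrable_const _)]
    simp only [integral_const, probReal_univ, one_smul]
    linarith

/-- Weak duality: a pricing measure gives no superreplicable claim a positive value. -/
theorem IsPricingMeasure.integral_nonpos (hQ : mkt.IsPricingMeasure P Q) {X : Ω → ℝ}
    (hX : X ∈ mkt.hedgeCone P mkt.gbar mkt.hbar) (hXi : Integrable X Q) : ∫ ω, X ω ∂Q ≤ 0 := by
  have := hQ.prob
  rw [hedgeCone_eq] at hX
  obtain ⟨c, w, hc, hw, H, hH, hle⟩ := hX
  have hwi : ∀ k, Integrable (w k) Q := fun k =>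
    memLp_one_iff_integrable.1 (memLp_of_mem_optionPayoffs hQ.ac (hw k))
  have hsi : Integrable (fun ω => ∑ k, c k * w k ω) Q :=
    integrable_finsetSum _ fun k _ => (hwi k).const_mul _
  have hs0 : ∫ ω, ∑ k, c k * w k ω ∂Q ≤ 0 := by
    rw [integral_finsetSum _ fun k _ => (hwi k).const_mul _]
    refine Finset.sum_nonpos fun k _ => ?_
    rw [integral_const_mul]
    exact mul_nonpos_of_nonneg_of_nonpos (hc k) (hQ.integral_optionPayoffs_nonpos (hw k))
  have hSi : ∀ t i, Integrable (fun ω => mkt.S t ω i) Q := fun t i =>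
    (hQ.martingale.integrable t).eval i
  have hle' : ∀ᵐ ω ∂Q, X ω - ∑ k, c k * w k ω ≤ ∑ i, H i ω * mkt.asset i ω := by
    filter_upwards [hQ.ac.ae_le hle] with ω h
    simpa [Finset.sum_apply] using h
  have hξi : ∀ i, Integrable (mkt.asset i) Q := by
    rintro (i | ⟨t, i⟩)
    exacts [(hQ.integrable_f i).sub (integrable_const _), (hSi _ i).sub (hSi _ i)]
  have hξ0 : ∀ i A, MeasurableSet[mkt.assetInfo i] A → ∫ ω in A, mkt.asset i ω ∂Q = 0 := by
    rintro (i | ⟨t, i⟩) A hA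
    · have h1 : ∫ ω, (mkt.f i ω - mkt.fbar i) ∂Q = 0 := by
        rw [integral_sub (hQ.integrable_f i) (integrable_const _), hQ.price_f i]
        simp
      rcases MeasurableSpace.measurableSet_bot_iff.1 hA with rfl | rfl
      · simp
      · rw [setIntegral_univ]
        exact h1
    · exact setIntegral_increment_eq_zero hQ.martingale t i hA
  obtain ⟨hVi, hV⟩ := integral_trading_nonpos assetRank assetInfo_mono assetInfo_le hξi hξ0
    Finset.univ H _ hH (hXi.sub hsi) hle'
  have h1 := integral_mono_ae (hXi.sub hsi) hVi hle'
  simp only [Pi.sub_apply] at h1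
  rw [integral_sub hXi hsi] at h1
  linarith

/-- An equivalent probability measure is a pricing measure if it gives no superreplicable claim a
positive value and if, for each option `g` or `h`, the values of its net payoffs have a negative
upper bound. -/
theorem isPricingMeasure_of_hedgeCone {ν : Measure Ω} [IsFiniteMeasure ν]
    [IsProbabilityMeasure Q] (hQP : Q ≪ P) (hPQ : P ≪ Q)
    (hint : ∀ X : Ω → ℝ, MemLp X 2 ν → Integrable X Q)
    (hS : ∀ t i, MemLp (fun ω => mkt.S t ω i) 2 ν) (hf : ∀ i, MemLp (mkt.f i) 2 ν)
    (hC : ∀ X ∈ mkt.hedgeCone P mkt.gbar mkt.hbar, MemLp X 2 ν → ∫ ω, X ω ∂Q ≤ 0)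
    (hstrict : ∀ i, ∃ δ > 0, ∀ w ∈ mkt.optionPayoffs P mkt.gbar mkt.hbar i,
      ∫ ω, w ω ∂Q ≤ -δ) : mkt.IsPricingMeasure P Q := by
  classical
  have hasset : ∀ i, MemLp (mkt.asset i) 2 ν := by
    rintro (i | ⟨t, i⟩)
    exacts [(hf i).sub (memLp_const _), (hS _ i).sub (hS _ i)]
  -- both directions of an elementary trade are superreplicable
  have hzero : ∀ i A, MeasurableSet[mkt.assetInfo i] A →
      ∫ ω in A, mkt.asset i ω ∂Q = 0 := by
    intro i A hA
    have hA' : MeasurableSet A := assetInfo_le i A hA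
    have hmem : ∀ c : ℝ, (fun ω => c * A.indicator (mkt.asset i) ω) ∈
        mkt.hedgeCone P mkt.gbar mkt.hbar := fun c => by
      refine tradingCone_subset_hedgeCone ⟨fun j => if j = i then A.indicator (fun _ => c) else 0,
        fun j => ?_, ae_of_all _ fun ω => le_of_eq ?_⟩
      · rcases eq_or_ne j i with rfl | hj
        · simpa only [if_true] using measurable_const.indicator hA
        · simp only [hj, if_false]
          exact measurable_const (a := (0 : ℝ))
      · dsimp only
        rw [Finset.sum_eq_single i (fun j _ hj => by simp [hj]) (by simp)]
        by_cases hω : ω ∈ A <;> simp [hω]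
    have h1 : ∀ c : ℝ, c * ∫ ω in A, mkt.asset i ω ∂Q ≤ 0 := fun c => by
      rw [← integral_indicator hA', ← integral_const_mul]
      exact hC _ (hmem c) (((hasset i).indicator hA').const_mul c)
    linarith [h1 1, h1 (-1)]
  refine ⟨inferInstance, hQP, hPQ, ?_, fun i => hint _ (hf i), fun i => ?_, fun j => ?_,
    fun k => ?_⟩
  · exact martingale_of_setIntegral_increment_eq_zero mkt.adapted_S (fun t i => hint _ (hS t i))
      fun t i A hA => hzero (Sum.inr (t, i)) A hA
  · have h1 : ∫ ω, (mkt.f i ω - mkt.fbar i) ∂Q = 0 := by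
      rw [← setIntegral_univ]
      exact hzero (Sum.inl i) Set.univ MeasurableSet.univ
    rw [integral_sub (hint _ (hf i)) (integrable_const _)] at h1
    simp only [integral_const, probReal_univ, one_smul] at h1
    linarith
  · obtain ⟨δ, hδ, h⟩ := hstrict (Sum.inl j)
    have h1 := h _ rfl
    obtain ⟨K, hK⟩ := mkt.bounded_g
    have hgi : Integrable (mkt.g j) Q := Integrable.of_bound
      ((mkt.measurable_g j).mono (mkt.ℱ.le _) le_rfl).aestronglyMeasurable K (ae_of_all _ (hK j))
    rw [integral_sub hgi (integrable_const _)] at h1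
    simp only [integral_const, probReal_univ, one_smul] at h1
    linarith
  · obtain ⟨δ, hδ, h⟩ := hstrict (Sum.inr k)
    refine lt_of_le_of_lt (b := ((mkt.hbar k - δ : ℝ) : EReal)) (iSup₂_le fun τ hτ => ?_)
      (EReal.coe_lt_coe_iff.2 (sub_lt_self _ hδ))
    rw [EReal.coe_le_coe_iff]
    have h1 := h _ ⟨_, isLiquidating_stop hτ, rfl⟩
    simp only [liquidate_stop] at h1
    have hmeas := measurable_liquidate (isLiquidating_stop (P := P) hτ).adapted (mkt.adapted_h k)
    obtain ⟨K, hK⟩ := mkt.bounded_h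
    have hhi : Integrable (fun ω => mkt.h k (τ ω) ω) Q := by
      refine Integrable.of_bound (Measurable.aestronglyMeasurable ?_) K
        (ae_of_all _ fun ω => hK k _ ω)
      rwa [funext fun ω => liquidate_stop τ (mkt.h k) ω] at hmeas
    rw [integral_sub hhi (integrable_const _)] at h1
    simp only [integral_const, probReal_univ, one_smul] at h1
    linarith

end Market

end SemiStatic

/-! ### Duality -/

namespace SemiStatic

variable {Ω : Type*} [mΩ : MeasurableSpace Ω] {P Q : Measure Ω} {T d L M N : ℕ}

theorem AEClosed.of_ac {ν : Measure Ω} {D : Set (Ω → ℝ)} (h : AEClosed P D) (hPν : P ≪ ν) :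
    AEClosed ν D :=
  fun X Y hX hlim => h X Y hX (hPν.ae_le hlim)

theorem IsClaimCone.of_ac {ν : Measure Ω} {D : Set (Ω → ℝ)} (h : IsClaimCone ⊥ P D)
    (hPν : P ≪ ν) : IsClaimCone ⊥ ν D :=
  ⟨h.zero_mem, h.add_mem, h.mul_mem, fun hX hYX => h.mono hX (hPν.ae_le hYX)⟩

theorem inner_toLp_eq_integral {ν : Measure Ω} (z : Lp ℝ 2 ν) {X : Ω → ℝ} (hX : MemLp X 2 ν) :
    inner ℝ z (hX.toLp X) = ∫ ω, z ω * X ω ∂ν := by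
  rw [Lp_inner_eq_integral]
  refine integral_congr_ae ?_
  filter_upwards [hX.coeFn_toLp] with ω h
  rw [h]

namespace Market

variable {mkt : Market Ω T d L M N} {W : Set (Ω → ℝ)}

theorem aeClosed_hedgeCone_of_SNA [IsProbabilityMeasure P] (hSNA : mkt.SNA P) :
    AEClosed P (mkt.hedgeCone P mkt.gbar mkt.hbar) := by
  obtain ⟨εg, εh, hεg, hεh, hNA⟩ := hSNA
  exact aeClosed_hedgeCone hεg hεh hNA

/-- The claims that can be superreplicated by a semi-static strategy together with one claim
chosen from `W`. -/
def hedgeSet (mkt : Market Ω T d L M N) (P : Measure Ω) (W : Set (Ω → ℝ)) : Set (Ω → ℝ) :=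
  {X | ∃ w ∈ W, X - w ∈ mkt.hedgeCone P mkt.gbar mkt.hbar}

theorem aeClosed_hedgeSet [IsProbabilityMeasure P] (hSNA : mkt.SNA P)
    (hW : ConvexlyCompact P W) : AEClosed P (mkt.hedgeSet P W) :=
  (aeClosed_hedgeCone_of_SNA hSNA).add_convexlyCompact isClaimCone_hedgeCone.convex hW

theorem hedgeSet_mono {X Y : Ω → ℝ} (hX : X ∈ mkt.hedgeSet P W) (hYX : Y ≤ᵐ[P] X) :
    Y ∈ mkt.hedgeSet P W := by
  obtain ⟨w, hw, h⟩ := hX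
  refine ⟨w, hw, isClaimCone_hedgeCone.mono h ?_⟩
  filter_upwards [hYX] with ω hω
  exact sub_le_sub_right hω _

theorem add_mem_hedgeSet {X w : Ω → ℝ} (hX : X ∈ mkt.hedgeCone P mkt.gbar mkt.hbar)
    (hw : w ∈ W) : X + w ∈ mkt.hedgeSet P W :=
  ⟨w, hw, by rwa [add_sub_cancel_right]⟩

theorem convex_hedgeSet (hW : Convex ℝ W) : Convex ℝ (mkt.hedgeSet P W) := by
  rintro X ⟨w, hw, hX⟩ Y ⟨v, hv, hY⟩ a b ha hb hab
  refine ⟨_, hW hw hv ha hb hab, ?_⟩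
  convert isClaimCone_hedgeCone.convex hX hY ha hb hab using 1
  simp only [smul_sub]
  abel

/-- The optimal superreplication level is attained. -/
theorem exists_isGreatest_hedgeSet [IsProbabilityMeasure P] (hSNA : mkt.SNA P)
    (hne : W.Nonempty) (hW : ConvexlyCompact P W) {K : ℝ}
    (hK : ∀ w ∈ W, ∀ᵐ ω ∂P, |w ω| ≤ K) :
    ∃ x₀ : ℝ, IsGreatest {x : ℝ | (fun _ => x) ∈ mkt.hedgeSet P W} x₀ := by
  set B : Set ℝ := {x : ℝ | (fun _ => x) ∈ mkt.hedgeSet P W} with hB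
  have hBne : B.Nonempty := by
    obtain ⟨w, hw⟩ := hne
    refine ⟨-K, w, hw, isClaimCone_hedgeCone.mono isClaimCone_hedgeCone.zero_mem ?_⟩
    filter_upwards [hK w hw] with ω h
    simp only [Pi.sub_apply, Pi.zero_apply]
    linarith [(abs_le.1 h).1]
  have hBb : BddAbove B := by
    refine ⟨K, fun x hx => ?_⟩
    obtain ⟨w, hw, hX⟩ := hx
    obtain ⟨εg, εh, hεg, hεh, hNA⟩ := hSNA
    by_contra! hlt
    have h0 := hNA.eq_zero (hedgeCone_anti (fun j => (sub_le_self _ (hεg j).le))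
      (fun k => (sub_le_self _ (hεh k).le)) hX) (by
        filter_upwards [hK w hw] with ω h
        simp only [Pi.sub_apply, Pi.zero_apply]
        linarith [(abs_le.1 h).2])
    obtain ⟨ω, h1, h2⟩ := (h0.and (hK w hw)).exists
    simp only [Pi.sub_apply, Pi.zero_apply] at h1
    linarith [(abs_le.1 h2).2]
  obtain ⟨u, -, hu, huB⟩ := exists_seq_tendsto_sSup hBne hBb
  exact ⟨sSup B, aeClosed_hedgeSet hSNA hW _ _ huB (ae_of_all _ fun _ => hu),
    fun x hx => le_csSup hBb hx⟩

/-- Strong duality: for a level that cannot be superreplicated together with any claim in `W`,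
some pricing measure gives all these claims at most that value. A separating density need not be
positive or strict for the options, so a small multiple of a Kreps–Yan density for lowered option
prices is added to it. -/
theorem exists_isPricingMeasure_of_notMem_hedgeSet [IsProbabilityMeasure P] (hSNA : mkt.SNA P)
    (hne : W.Nonempty) (hconv : Convex ℝ W) (hW : ConvexlyCompact P W)
    (hm : ∀ w ∈ W, Measurable w) {K : ℝ} (hK : ∀ w ∈ W, ∀ᵐ ω ∂P, |w ω| ≤ K) {x : ℝ}
    (hx : (fun _ => x) ∉ mkt.hedgeSet P W) :
    ∃ Q, mkt.IsPricingMeasure P Q ∧ ∀ w ∈ W, ∫ ω, w ω ∂Q ≤ x := by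
  have hSNA' := hSNA
  obtain ⟨εg, εh, hεg, hεh, hNA⟩ := hSNA'
  set C := mkt.hedgeCone P mkt.gbar mkt.hbar with hC
  set C' := mkt.hedgeCone P (fun j => mkt.gbar j - εg j / 2) (fun k => mkt.hbar k - εh k / 2)
    with hC'
  have hCC' : C ⊆ C' := hedgeCone_anti (fun j => by linarith [hεg j]) (fun k => by linarith [hεh k])
  have hC'cl : AEClosed P C' := by
    refine aeClosed_hedgeCone (fun j => half_pos (hεg j)) (fun k => half_pos (hεh k)) ?_
    convert hNA using 2 <;> ring
  have hC'NA : ∀ X ∈ C', 0 ≤ᵐ[P] X → X =ᵐ[P] 0 := fun X hX h0 =>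
    hNA.eq_zero (hedgeCone_anti (fun j => by linarith [hεg j]) (fun k => by linarith [hεh k]) hX) h0
  -- an equivalent measure under which everything relevant is square integrable
  obtain ⟨ν, hνf, hνP, hPν, hν2⟩ := exists_equivalent_memLp_two (P := P)
    (F := Sum.elim (fun ti : Fin (T + 1) × Fin d => fun ω => mkt.S ti.1 ω ti.2) mkt.f) (by
      rintro (⟨t, i⟩ | i)
      · exact (measurable_pi_apply i).comp ((mkt.adapted_S t).mono (mkt.ℱ.le _) le_rfl)
      · exact (mkt.measurable_f i).mono (mkt.ℱ.le _) le_rfl)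
  have hν0 : ν ≠ 0 := by
    rintro rfl
    exact IsProbabilityMeasure.ne_zero P (Measure.absolutelyContinuous_zero_iff.1 hPν)
  have hWL : ∀ w ∈ W, MemLp w 2 ν := fun w hw =>
    MemLp.of_bound (hm w hw).aestronglyMeasurable K (hνP.ae_le (hK w hw))
  set e : Lp ℝ 2 ν := (memLp_const (1 : ℝ)).toLp _ with he
  have hecoe : ∀ᵐ ω ∂ν, e ω = 1 := (memLp_const (1 : ℝ)).coeFn_toLp
  have hint : ∀ z : Lp ℝ 2 ν, inner ℝ z e = ∫ ω, z ω ∂ν := fun z => by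
    rw [he, inner_toLp_eq_integral]; simp
  obtain ⟨z₁, hz₁, hz₁pos⟩ := exists_pos_mem_polarDensities (isClaimCone_hedgeCone.of_ac hPν)
    (hC'cl.of_ac hPν) fun X hX h0 => hνP.ae_le (hC'NA X hX (hPν.ae_le h0))
  -- separation of the constant `x` from the superreplicable claims
  obtain ⟨w₀, hw₀⟩ := hne
  have hw₀A : (((hWL w₀ hw₀).toLp w₀ : Lp ℝ 2 ν) : Ω → ℝ) ∈ mkt.hedgeSet P W := by
    refine hedgeSet_mono (add_mem_hedgeSet isClaimCone_hedgeCone.zero_mem hw₀) ?_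
    filter_upwards [hPν.ae_le (hWL w₀ hw₀).coeFn_toLp] with ω h
    rw [h, zero_add]
  have hxA : ((x • e : Lp ℝ 2 ν) : Ω → ℝ) ∉ mkt.hedgeSet P W := fun h => by
    refine hx (hedgeSet_mono h ?_)
    filter_upwards [hPν.ae_le (Lp.coeFn_smul x e), hPν.ae_le hecoe] with ω h1 h2
    rw [h1, Pi.smul_apply, h2, smul_eq_mul, mul_one]
  obtain ⟨z, hz0, u, hzu, huz⟩ := exists_nonneg_separating (convex_hedgeSet hconv)
    ((aeClosed_hedgeSet hSNA hW).of_ac hPν)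
    (fun hX hYX => hedgeSet_mono hX (hPν.ae_le hYX)) hw₀A hxA
  have hzC : z ∈ polarDensities ν C := by
    refine ⟨hz0, fun y hy => ?_⟩
    by_contra! hpos
    obtain ⟨n, hn⟩ := exists_nat_gt ((u - inner ℝ z ((hWL w₀ hw₀).toLp w₀)) / inner ℝ z y)
    rw [div_lt_iff₀ hpos] at hn
    have := hzu ((n : ℝ) • y + (hWL w₀ hw₀).toLp w₀) (hedgeSet_mono
      (add_mem_hedgeSet (isClaimCone_hedgeCone.smul_mem n.cast_nonneg hy) hw₀) (by
        filter_upwards [hPν.ae_le (Lp.coeFn_add ((n : ℝ) • y) ((hWL w₀ hw₀).toLp w₀)),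
          hPν.ae_le (Lp.coeFn_smul (n : ℝ) y), hPν.ae_le (hWL w₀ hw₀).coeFn_toLp] with ω h1 h2 h3
        rw [h1, Pi.add_apply, h2, h3]
        rfl))
    rw [inner_add_right, real_inner_smul_right] at this
    linarith
  have hzW : ∀ w (hw : w ∈ W), inner ℝ z ((hWL w hw).toLp w) ≤ u := fun w hw =>
    (hzu _ (hedgeSet_mono (add_mem_hedgeSet isClaimCone_hedgeCone.zero_mem hw) (by
      filter_upwards [hPν.ae_le (hWL w hw).coeFn_toLp] with ω h
      rw [h, zero_add]))).le
  have hI₁ : 0 < inner ℝ z₁ e := by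
    rw [hint, integral_pos_iff_support_of_nonneg_ae (hz₁pos.mono fun _ h => h.le)
      ((Lp.memLp z₁).integrable one_le_two)]
    refine pos_iff_ne_zero.2 fun h => hν0 (ae_eq_bot.1 (eventually_false_iff_eq_bot.1 ?_))
    filter_upwards [measure_eq_zero_iff_ae_notMem.1 h, hz₁pos] with ω h1 h2
    exact h1 h2.ne'
  have hz₁W : ∀ w (hw : w ∈ W), inner ℝ z₁ ((hWL w hw).toLp w) ≤ K * inner ℝ z₁ e :=
    fun w hw => by
      rw [inner_toLp_eq_integral, hint, ← integral_const_mul]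
      refine integral_mono_ae ((Lp.memLp z₁).integrable_mul (hWL w hw))
        (((Lp.memLp z₁).integrable one_le_two).const_mul K) ?_
      filter_upwards [hνP.ae_le (hK w hw), hz₁pos] with ω h1 h2
      change z₁ ω * w ω ≤ K * z₁ ω
      nlinarith [(abs_le.1 h1).2]
  rw [real_inner_smul_right] at huz
  -- the weight of `z₁` is so small that the separation survives
  set δ : ℝ := x * inner ℝ z e - u with hδ
  have hδ0 : 0 < δ := sub_pos.2 huz
  set θ : ℝ := δ / (|K - x| * inner ℝ z₁ e + 1) with hθ
  have hden : 0 < |K - x| * inner ℝ z₁ e + 1 := by positivity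
  have hθ0 : 0 < θ := div_pos hδ0 hden
  have hθδ : θ * (K - x) * inner ℝ z₁ e ≤ δ := by
    have h1 : θ * (|K - x| * inner ℝ z₁ e + 1) = δ := div_mul_cancel₀ _ hden.ne'
    have h2 : θ * (K - x) * inner ℝ z₁ e ≤ θ * |K - x| * inner ℝ z₁ e := by
      gcongr
      exact le_abs_self _
    linarith
  set Z : Lp ℝ 2 ν := z + θ • z₁ with hZ
  have hZpos : ∀ᵐ ω ∂ν, 0 < Z ω := by
    filter_upwards [Lp.coeFn_add z (θ • z₁), Lp.coeFn_smul θ z₁, hz₁pos,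
      (Lp.coeFn_nonneg z).2 hz0] with ω h1 h2 h3 h4
    rw [h1, Pi.add_apply, h2, Pi.smul_apply, smul_eq_mul]
    exact add_pos_of_nonneg_of_pos h4 (mul_pos hθ0 h3)
  have hZin : ∀ y, inner ℝ Z y = inner ℝ z y + θ * inner ℝ z₁ y := fun y => by
    rw [hZ, inner_add_left, real_inner_smul_left]
  have hze : 0 ≤ inner ℝ z e := by
    rw [hint]
    exact integral_nonneg_of_ae ((Lp.coeFn_nonneg z).2 hz0)
  have hZe : 0 < inner ℝ Z e := by
    rw [hZin]
    exact add_pos_of_nonneg_of_pos hze (mul_pos hθ0 hI₁)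
  obtain ⟨Q, hQ, hQν, hνQ, hQint⟩ := exists_probabilityMeasure_of_density hν0 hZpos
  have hQeq : ∀ X (hX : MemLp X 2 ν), ∫ ω, X ω ∂Q = (inner ℝ Z e)⁻¹ * inner ℝ Z (hX.toLp X) :=
    fun X hX => by rw [(hQint X hX).2, hint, inner_toLp_eq_integral]
  have hmemC : ∀ {X} (hX : MemLp X 2 ν), X ∈ C → ((hX.toLp X : Lp ℝ 2 ν) : Ω → ℝ) ∈ C :=
    fun hX hXC => isClaimCone_hedgeCone.mono hXC (hX.coeFn_toLp.filter_mono hPν.ae_le).le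
  refine ⟨Q, isPricingMeasure_of_hedgeCone (hQν.trans hνP) (hPν.trans hνQ)
    (fun X hX => (hQint X hX).1) (fun t i => hν2 (Sum.inl (t, i))) (fun i => hν2 (Sum.inr i))
    (fun X hX hX2 => ?_) (fun i => ?_), fun w hw => ?_⟩
  · rw [hQeq X hX2, hZin (hX2.toLp X)]
    have h1 := hzC.2 _ (hmemC hX2 hX)
    have h2 := hz₁.2 _ (hCC' (hmemC hX2 hX))
    exact mul_nonpos_of_nonneg_of_nonpos (inv_pos.2 hZe).le
      (add_nonpos h1 (mul_nonpos_of_nonneg_of_nonpos hθ0.le h2))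
  · obtain ⟨ε, hε0, hε⟩ := exists_add_mem_optionPayoffs (P := P) (mkt := mkt) (pg := mkt.gbar)
      (ph := mkt.hbar) (fun j => half_pos (hεg j)) (fun k => half_pos (hεh k)) i
    refine ⟨(inner ℝ Z e)⁻¹ * (θ * (ε * inner ℝ z₁ e)), by positivity, fun w hw => ?_⟩
    have hw2 : MemLp w 2 ν := memLp_of_mem_optionPayoffs hνP hw
    have h1 := hzC.2 _ (hmemC hw2 (optionPayoffs_subset_hedgeCone i hw))
    have h2 := hz₁.2 (hw2.toLp w + ε • e) (isClaimCone_hedgeCone.mono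
      (optionPayoffs_subset_hedgeCone i (hε w hw)) (by
        filter_upwards [hPν.ae_le (Lp.coeFn_add (hw2.toLp w) (ε • e)),
          hPν.ae_le (Lp.coeFn_smul ε e), hPν.ae_le hw2.coeFn_toLp, hPν.ae_le hecoe]
          with ω h1 h2 h3 h4
        rw [h1, Pi.add_apply, h2, Pi.smul_apply, h3, h4, smul_eq_mul, mul_one]))
    rw [inner_add_right, real_inner_smul_right] at h2
    rw [hQeq w hw2, hZin (hw2.toLp w), ← mul_neg]
    refine mul_le_mul_of_nonneg_left ?_ (inv_pos.2 hZe).le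
    have h3 := mul_nonpos_of_nonneg_of_nonpos hθ0.le h2
    linarith
  · rw [hQeq w (hWL w hw), inv_mul_le_iff₀ hZe, hZin, hZin]
    have h1 := hzW w hw
    have h2 := mul_le_mul_of_nonneg_left (hz₁W w hw) hθ0.le
    nlinarith

/-- Weak duality, for superreplication together with a claim from `W`. -/
theorem IsPricingMeasure.le_integral [IsProbabilityMeasure P] (hQ : mkt.IsPricingMeasure P Q)
    {w : Ω → ℝ} (hw : Measurable w) {K : ℝ} (hK : ∀ᵐ ω ∂P, |w ω| ≤ K) {x : ℝ}
    (hx : (fun _ => x) - w ∈ mkt.hedgeCone P mkt.gbar mkt.hbar) : x ≤ ∫ ω, w ω ∂Q := by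
  have := hQ.prob
  have hwi : Integrable w Q := Integrable.of_bound hw.aestronglyMeasurable K (hQ.ac.ae_le hK)
  have h1 := hQ.integral_nonpos hx ((integrable_const x).sub hwi)
  simp only [Pi.sub_apply] at h1
  rw [integral_sub (integrable_const x) hwi] at h1
  simp only [integral_const, probReal_univ, one_smul] at h1
  linarith

theorem sub_mem_hedgeCone_iff {x : ℝ} {w : Ω → ℝ} :
    (fun _ => x) - w ∈ mkt.hedgeCone P mkt.gbar mkt.hbar ↔
      ∃ s, mkt.Admissible P s ∧
        ∀ᵐ ω ∂P, x ≤ mkt.terminalValue mkt.gbar mkt.hbar s ω + w ω := by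
  refine exists_congr fun s => and_congr_right fun _ => eventually_congr (ae_of_all _ fun ω => ?_)
  simp only [Pi.sub_apply]
  exact sub_le_iff_le_add

/-- Duality and attainment for a European claim. -/
theorem subHedgeEu_eq [IsProbabilityMeasure P] (hSNA : mkt.SNA P) {ψ : Ω → ℝ}
    (hψ : Measurable ψ) {K : ℝ} (hK : ∀ ω, |ψ ω| ≤ K) :
    mkt.subHedgeEu P ψ
        = ⨅ (Q : Measure Ω) (_ : mkt.IsPricingMeasure P Q), ((∫ ω, ψ ω ∂Q : ℝ) : EReal) ∧
    ∃ s, mkt.Admissible P s ∧ ∀ᵐ ω ∂P, mkt.subHedgeEu P ψ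
      ≤ ((mkt.terminalValue mkt.gbar mkt.hbar s ω + ψ ω : ℝ) : EReal) := by
  have hψK : ∀ w ∈ ({ψ} : Set (Ω → ℝ)), ∀ᵐ ω ∂P, |w ω| ≤ K := by
    rintro _ rfl
    exact ae_of_all _ hK
  obtain ⟨x, hx, hmax⟩ := exists_isGreatest_hedgeSet hSNA (Set.singleton_nonempty ψ)
    (convexlyCompact_singleton ψ) hψK
  have hmem : ∀ y : ℝ, (fun _ => y) ∈ mkt.hedgeSet P {ψ} ↔ ∃ s, mkt.Admissible P s ∧
      ∀ᵐ ω ∂P, y ≤ mkt.terminalValue mkt.gbar mkt.hbar s ω + ψ ω := fun y => by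
    rw [← sub_mem_hedgeCone_iff]
    exact ⟨fun ⟨_, hw, h⟩ => by rwa [← show _ = ψ from hw], fun h => ⟨ψ, rfl, h⟩⟩
  have hval : mkt.subHedgeEu P ψ = (x : EReal) := by
    refine le_antisymm (sSup_le ?_) (le_sSup ⟨x, rfl, (hmem x).1 hx⟩)
    rintro _ ⟨y, rfl, hy⟩
    exact EReal.coe_le_coe_iff.2 (hmax ((hmem y).2 hy))
  rw [hval]
  refine ⟨le_antisymm (le_iInf₂ fun Q hQ => ?_) ?_, ?_⟩
  · exact EReal.coe_le_coe_iff.2 (hQ.le_integral hψ (ae_of_all _ hK)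
      (sub_mem_hedgeCone_iff.2 ((hmem x).1 hx)))
  · refine EReal.le_of_forall_lt_iff_le.1 fun y hy => ?_
    obtain ⟨Q, hQ, h⟩ := exists_isPricingMeasure_of_notMem_hedgeSet hSNA
      (Set.singleton_nonempty ψ) (convex_singleton ψ) (convexlyCompact_singleton ψ)
      (by rintro _ rfl; exact hψ) hψK
      fun h => (EReal.coe_lt_coe_iff.1 hy).not_ge (hmax h)
    exact (iInf₂_le Q hQ).trans (EReal.coe_le_coe_iff.2 (h ψ rfl))
  · obtain ⟨s, hs, h⟩ := (hmem x).1 hx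
    exact ⟨s, hs, h.mono fun ω hω => EReal.coe_le_coe_iff.2 hω⟩

/-- Duality and attainment for an American claim. -/
theorem subHedgeAm_eq [IsProbabilityMeasure P] (hSNA : mkt.SNA P) {φ : Fin (T + 1) → Ω → ℝ}
    (hφ : Adapted mkt.ℱ φ) {K : ℝ} (hK : ∀ t ω, |φ t ω| ≤ K) :
    mkt.subHedgeAm P φ
        = ⨅ (Q : Measure Ω) (_ : mkt.IsPricingMeasure P Q), optimalStoppingValue mkt.ℱ Q φ ∧
    ∃ s η, mkt.Admissible P s ∧ IsLiquidating mkt.ℱ P η ∧ ∀ᵐ ω ∂P, mkt.subHedgeAm P φ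
      ≤ ((mkt.terminalValue mkt.gbar mkt.hbar s ω + liquidate η φ ω : ℝ) : EReal) := by
  set W : Set (Ω → ℝ) := {w | ∃ η, IsLiquidating mkt.ℱ P η ∧ w = fun ω => liquidate η φ ω - 0}
    with hWdef
  have hWK : ∀ w ∈ W, ∀ᵐ ω ∂P, |w ω| ≤ K := by
    rintro _ ⟨η, hη, rfl⟩
    simpa only [sub_zero] using hη.abs_liquidate_le hK
  have hWm : ∀ w ∈ W, Measurable w := by
    rintro _ ⟨η, hη, rfl⟩
    exact (measurable_liquidate hη.adapted hφ).sub_const 0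
  have hWne : W.Nonempty := by
    obtain ⟨η, hη⟩ := exists_isLiquidating P mkt.ℱ
    exact ⟨_, η, hη, rfl⟩
  obtain ⟨x, hx, hmax⟩ := exists_isGreatest_hedgeSet hSNA hWne
    (convexlyCompact_liquidate φ 0) hWK
  have hmem : ∀ y : ℝ, (fun _ => y) ∈ mkt.hedgeSet P W ↔ ∃ s η, mkt.Admissible P s ∧
      IsLiquidating mkt.ℱ P η ∧
      ∀ᵐ ω ∂P, y ≤ mkt.terminalValue mkt.gbar mkt.hbar s ω + liquidate η φ ω := fun y => by
    constructor
    · rintro ⟨_, ⟨η, hη, rfl⟩, h⟩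
      obtain ⟨s, hs, h⟩ := sub_mem_hedgeCone_iff.1 h
      exact ⟨s, η, hs, hη, by simpa only [sub_zero] using h⟩
    · rintro ⟨s, η, hs, hη, h⟩
      exact ⟨_, ⟨η, hη, rfl⟩, sub_mem_hedgeCone_iff.2 ⟨s, hs, by simpa only [sub_zero] using h⟩⟩
  have hval : mkt.subHedgeAm P φ = (x : EReal) := by
    refine le_antisymm (sSup_le ?_) (le_sSup ⟨x, rfl, (hmem x).1 hx⟩)
    rintro _ ⟨y, rfl, hy⟩
    exact EReal.coe_le_coe_iff.2 (hmax ((hmem y).2 hy))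
  rw [hval]
  refine ⟨le_antisymm (le_iInf₂ fun Q hQ => ?_) ?_, ?_⟩
  · obtain ⟨s, η, hs, hη, h⟩ := (hmem x).1 hx
    have := hQ.prob
    refine le_trans ?_ (integral_liquidate_le_optimalStoppingValue hQ.ac hη hφ hK)
    exact EReal.coe_le_coe_iff.2 (hQ.le_integral (measurable_liquidate hη.adapted hφ)
      (hη.abs_liquidate_le hK) (sub_mem_hedgeCone_iff.2 ⟨s, hs, h⟩))
  · refine EReal.le_of_forall_lt_iff_le.1 fun y hy => ?_
    obtain ⟨Q, hQ, h⟩ := exists_isPricingMeasure_of_notMem_hedgeSet hSNA hWne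
      (convex_liquidate φ 0) (convexlyCompact_liquidate φ 0) hWm hWK
      fun h => (EReal.coe_lt_coe_iff.1 hy).not_ge (hmax h)
    -- stopping at `τ` is one way to liquidate
    refine (iInf₂_le Q hQ).trans (iSup₂_le fun τ hτ => EReal.coe_le_coe_iff.2 ?_)
    simpa only [liquidate_stop, sub_zero] using h _ ⟨_, isLiquidating_stop hτ, rfl⟩
  · obtain ⟨s, η, hs, hη, h⟩ := (hmem x).1 hx
    exact ⟨s, η, hs, hη, h.mono fun ω hω => EReal.coe_le_coe_iff.2 hω⟩

end Market

end SemiStatic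

theorem theorem3p2 {Ω : Type*} [mΩ : MeasurableSpace Ω] (P : Measure Ω)
    [IsProbabilityMeasure P] [IsSeparable P] {T d L M N : ℕ}
    (mkt : SemiStatic.Market Ω T d L M N) (hSNA : mkt.SNA P)
    (ψ : Ω → ℝ) (hψ : Measurable[mkt.ℱ (Fin.last T)] ψ) (hψb : ∃ K : ℝ, ∀ ω, |ψ ω| ≤ K)
    (φ : Fin (T + 1) → Ω → ℝ) (hφ : Adapted mkt.ℱ φ) (hφb : ∃ K : ℝ, ∀ t ω, |φ t ω| ≤ K) :
    mkt.subHedgeEu P ψ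
        = ⨅ (Q : Measure Ω) (_ : mkt.IsPricingMeasure P Q), ((∫ ω, ψ ω ∂Q : ℝ) : EReal) ∧
    mkt.subHedgeAm P φ
        = ⨅ (Q : Measure Ω) (_ : mkt.IsPricingMeasure P Q),
            SemiStatic.optimalStoppingValue mkt.ℱ Q φ ∧
    (∃ s : SemiStatic.Strategy Ω T d L M N, mkt.Admissible P s ∧
      ∀ᵐ ω ∂P, mkt.subHedgeEu P ψ
        ≤ ((mkt.terminalValue mkt.gbar mkt.hbar s ω + ψ ω : ℝ) : EReal)) ∧
    (∃ (s : SemiStatic.Strategy Ω T d L M N) (η : Fin (T + 1) → Ω → ℝ),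
      mkt.Admissible P s ∧ SemiStatic.IsLiquidating mkt.ℱ P η ∧
      ∀ᵐ ω ∂P, mkt.subHedgeAm P φ
        ≤ ((mkt.terminalValue mkt.gbar mkt.hbar s ω
            + SemiStatic.liquidate η φ ω : ℝ) : EReal)) := by
  obtain ⟨K, hK⟩ := hψb
  obtain ⟨K', hK'⟩ := hφb
  obtain ⟨h₁, h₂⟩ := SemiStatic.Market.subHedgeEu_eq hSNA (hψ.mono (mkt.ℱ.le _) le_rfl) hK
  obtain ⟨h₃, h₄⟩ := SemiStatic.Market.subHedgeAm_eq hSNA hφ hK'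
  exact ⟨h₁, h₃, h₂, h₄⟩
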